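/- Let $T>0$, let $H(t)=H(t)^\dagger\in\mathbb C^{m\times m}$ and $\gamma_1(t),\dots,\gamma_K(t)\ge 0$ be twice continuously differentiable on $[0,T]$, let $L_1,\dots,L_K\in\mathbb C^{m\times m}$, and consider the Lindblad equation on $[0,T]$ $$\dot\rho(t)=-i[H(t),\rho(t)]+\sum_{k=1}^K\gamma_k(t)\Big(L_k\rho(t)L_k^\dagger-\tfrac12\{L_k^\dagger L_k,\rho(t)\}\Big).\qquad(1)$$ A density matrix is a Hermitian positive semidefinite matrix of trace one, and $\|X\|_1=\operatorname{Tr}\sqrt{X^\dagger X}$ is the trace norm. Put $A(t)=-iH(t)-\frac12\sum_k\gamma_k(t)L_k^\dagger L_k$. For an integer $N\ge1$ let $\tau=T/N$, $t_s=s\tau$, $A_s=A(t_s)$, and for $0\le n\le N-1$ let $\Phi(t_n,X)$ be one step of the full-rank exponential midpoint (FREM) scheme, $$Y=e^{\frac\tau2A_n}\Big(X+\tfrac\tau2\sum_k\gamma_k(t_n)L_kXL_k^\dagger\Big)e^{\frac\tau2A_n^\dagger},$$ $$\Phi(t_n,X)=e^{\tau A_{n+1/2}}Xe^{\tau A_{n+1/2}^\dagger}+\tau\sum_k\gamma_k(t_{n+1/2})\,e^{\frac\tau2A_{n+1/2}}L_kYL_k^\dagger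 e^{\frac\tau2A_{n+1/2}^\dagger}.$$ The normalized FREM scheme is $\rho_0=\rho(0)$, $\rho_{n+1}=\Phi(t_n,\rho_n)/\operatorname{Tr}\Phi(t_n,\rho_n)$ for $0\le n\le N-1$. (a) There is a constant $C_1>0$, depending only on $H$, $L_k$, $\gamma_k$ and $T$, such that $$\|\varrho(t_{n+1})-\Phi(t_n,\varrho(t_n))\|_1\le C_1\tau^3\qquad(2)$$ for all $N\ge1$, all $0\le n\le N-1$ and all solutions $\varrho$ of (1) on $[t_n,t_{n+1}]$ for which $\varrho(t_n)$ is a density matrix. (b) Let $C_1$ be any constant with the property in (a), let $C_2=\sum_{k=1}^K\big(\max_{0\le t\le T}\gamma_k(t)\big)\|L_k\|_1^2$, and let $C_3=\frac{C_1}{C_2}(e^{C_2T}-1)$ (read as $C_1T$ if $C_2=0$). Then for every solution $\rho$ of (1) on $[0,T]$ for which $\rho(0)$ is a density matrix, and for every $N\ge1$, the normalized FREM scheme satisfies $$\|\rho(t_n)-\rho_n\|_1\le 2C_3\,\tau^2,\qquad 0\le n\le N.$$ -/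

import Mathlib

open scoped Matrix ComplexOrder

namespace LindbladFREM

/-- The trace norm `‖X‖₁ = Tr √(X† X)`: the sum of the singular values of `X`, i.e. of the square
roots of the eigenvalues of `X† X`, counted with multiplicity. -/
noncomputable def traceNorm {m : ℕ} (X : Matrix (Fin m) (Fin m) ℂ) : ℝ :=
  ∑ j, Real.sqrt ((Matrix.isHermitian_conjTranspose_mul_self X).eigenvalues j)

/-- Hermitian positive semidefinite matrices with unit trace. -/
def IsDensity {m : ℕ} (X : Matrix (Fin m) (Fin m) ℂ) : Prop :=
  X.PosSemidef ∧ X.trace = 1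

/-- Right-hand side of the forward Lindblad equation at time `t`:
`-i [H(t), X] + ∑ₖ γₖ(t) (Lₖ X Lₖ† - ½ {Lₖ† Lₖ, X})`. -/
noncomputable def lindbladRHS {m K : ℕ} (H : ℝ → Matrix (Fin m) (Fin m) ℂ)
    (L : Fin K → Matrix (Fin m) (Fin m) ℂ) (γ : Fin K → ℝ → ℝ)
    (t : ℝ) (X : Matrix (Fin m) (Fin m) ℂ) : Matrix (Fin m) (Fin m) ℂ :=
  (-Complex.I) • (H t * X - X * H t) +
    ∑ k, (γ k t : ℂ) • (L k * X * (L k)ᴴ -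
      (1 / 2 : ℂ) • ((L k)ᴴ * L k * X + X * ((L k)ᴴ * L k)))

/-- `ρ` solves the forward Lindblad equation on `[a, b]` (entrywise derivatives, one-sided at the
end points). -/
def IsLindbladSolution {m K : ℕ} (H : ℝ → Matrix (Fin m) (Fin m) ℂ)
    (L : Fin K → Matrix (Fin m) (Fin m) ℂ) (γ : Fin K → ℝ → ℝ)
    (a b : ℝ) (ρ : ℝ → Matrix (Fin m) (Fin m) ℂ) : Prop :=
  ∀ t ∈ Set.Icc a b, ∀ i j,
    HasDerivWithinAt (fun s => ρ s i j) (lindbladRHS H L γ t (ρ t) i j) (Set.Icc a b) t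

/-- `A(t) = -i H(t) - ½ ∑ₖ γₖ(t) Lₖ† Lₖ`. -/
noncomputable def generator {m K : ℕ} (H : ℝ → Matrix (Fin m) (Fin m) ℂ)
    (L : Fin K → Matrix (Fin m) (Fin m) ℂ) (γ : Fin K → ℝ → ℝ)
    (t : ℝ) : Matrix (Fin m) (Fin m) ℂ :=
  (-Complex.I) • H t - (1 / 2 : ℂ) • ∑ k, (γ k t : ℂ) • ((L k)ᴴ * L k)

/-- The half-step value
`e^{τ/2 A(t)} (X + τ/2 ∑ₖ γₖ(t) Lₖ X Lₖ†) e^{τ/2 A(t)†}`. -/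
noncomputable def fremHalf {m K : ℕ} (H : ℝ → Matrix (Fin m) (Fin m) ℂ)
    (L : Fin K → Matrix (Fin m) (Fin m) ℂ) (γ : Fin K → ℝ → ℝ)
    (τ t : ℝ) (X : Matrix (Fin m) (Fin m) ℂ) : Matrix (Fin m) (Fin m) ℂ :=
  NormedSpace.exp (((τ / 2 : ℝ) : ℂ) • generator H L γ t) *
    (X + ((τ / 2 : ℝ) : ℂ) • ∑ k, (γ k t : ℂ) • (L k * X * (L k)ᴴ)) *
    NormedSpace.exp (((τ / 2 : ℝ) : ℂ) • (generator H L γ t)ᴴ)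

/-- One step `Φ(t, X)` of the full-rank exponential midpoint scheme with step size `τ`, where
`B = A(t + τ/2)` and `Y` is the half-step value:
`e^{τ B} X e^{τ B†} + τ ∑ₖ γₖ(t + τ/2) e^{τ/2 B} Lₖ Y Lₖ† e^{τ/2 B†}`. -/
noncomputable def fremStep {m K : ℕ} (H : ℝ → Matrix (Fin m) (Fin m) ℂ)
    (L : Fin K → Matrix (Fin m) (Fin m) ℂ) (γ : Fin K → ℝ → ℝ)
    (τ t : ℝ) (X : Matrix (Fin m) (Fin m) ℂ) : Matrix (Fin m) (Fin m) ℂ :=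
  NormedSpace.exp ((τ : ℂ) • generator H L γ (t + τ / 2)) * X *
      NormedSpace.exp ((τ : ℂ) • (generator H L γ (t + τ / 2))ᴴ) +
    (τ : ℂ) • ∑ k, (γ k (t + τ / 2) : ℂ) •
      (NormedSpace.exp (((τ / 2 : ℝ) : ℂ) • generator H L γ (t + τ / 2)) *
        (L k * fremHalf H L γ τ t X * (L k)ᴴ) *
        NormedSpace.exp (((τ / 2 : ℝ) : ℂ) • (generator H L γ (t + τ / 2))ᴴ))

/-- The normalized scheme with step size `τ` on the grid `tₙ = n τ`, started at `X₀`: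
`ρₙ₊₁ = Φ(tₙ, ρₙ) / Tr Φ(tₙ, ρₙ)`. -/
noncomputable def normalizedFREM {m K : ℕ} (H : ℝ → Matrix (Fin m) (Fin m) ℂ)
    (L : Fin K → Matrix (Fin m) (Fin m) ℂ) (γ : Fin K → ℝ → ℝ)
    (τ : ℝ) (X₀ : Matrix (Fin m) (Fin m) ℂ) : ℕ → Matrix (Fin m) (Fin m) ℂ
  | 0 => X₀
  | n + 1 =>
    (fremStep H L γ τ (n * τ) (normalizedFREM H L γ τ X₀ n)).trace⁻¹ •
      fremStep H L γ τ (n * τ) (normalizedFREM H L γ τ X₀ n)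

/-- `C₁` is a truncation error constant: on every uniform grid `tₙ = n τ`, `τ = T / N`, of `[0, T]`,
one (unnormalized) step started on any solution of the Lindblad equation that is a density
matrix at time `tₙ` has trace norm error at most `C₁ τ³`. -/
def IsTruncationConst {m K : ℕ} (H : ℝ → Matrix (Fin m) (Fin m) ℂ)
    (L : Fin K → Matrix (Fin m) (Fin m) ℂ) (γ : Fin K → ℝ → ℝ) (T C₁ : ℝ) : Prop :=
  ∀ N : ℕ, 0 < N → ∀ n : ℕ, n < N → ∀ ρ : ℝ → Matrix (Fin m) (Fin m) ℂ,
    IsLindbladSolution H L γ (n * (T / N)) ((n + 1) * (T / N)) ρ →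
    IsDensity (ρ (n * (T / N))) →
    traceNorm (ρ ((n + 1) * (T / N)) - fremStep H L γ (T / N) (n * (T / N)) (ρ (n * (T / N))))
      ≤ C₁ * (T / N) ^ 3

/-- `C₂ = ∑ₖ (max_{0 ≤ t ≤ T} γₖ(t)) ‖Lₖ‖₁²`. -/
noncomputable def stabilityConst {m K : ℕ} (L : Fin K → Matrix (Fin m) (Fin m) ℂ)
    (γ : Fin K → ℝ → ℝ) (T : ℝ) : ℝ :=
  ∑ k, sSup (γ k '' Set.Icc 0 T) * traceNorm (L k) ^ 2

/-- `C₃ = (C₁ / C₂) (e^{C₂ T} - 1)`, to be read as its limit `C₁ T` if `C₂ = 0`. -/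
noncomputable def errorConst (C₁ C₂ T : ℝ) : ℝ :=
  if C₂ = 0 then C₁ * T else C₁ / C₂ * (Real.exp (C₂ * T) - 1)

end LindbladFREM

/-! With `J` the jump map, the equation reads `ρ' = A ρ + ρ A† + J ρ =: Λ(t) ρ`. Freeze `Λ` at the
midpoint of a step. By symmetry about the midpoint, the exact flow agrees with `1 + τ Λ + (τ² / 2)
Λ²` up to `O(τ³)` (`exists_flow_expansion_bound`); expanding the exponentials gives the same
quadratic for the scheme (`isBigO_scheme_sub`). Both remainders are uniform over initial values in a
ball, which gives (a).

For (b), drop the normalization first. The step is linear, and in trace norm it grows by at most `1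
+ C₂ τ + (C₂ τ)² / 2 ≤ e^{C₂ τ}` (`traceNorm_fremStep_le`): the exponentials are contractions
because `-(A + A†)` is positive semidefinite, and each jump term is bounded through `‖L‖ ≤ ‖L‖₁`. A
discrete Grönwall argument turns the local error `C₁ τ³` into `C₃ τ²`. Homogeneity of the step shows
that the normalized iterate is the unnormalized one divided by its trace (`normalizedFREM_eq`), and
that division at most doubles the distance to a matrix of trace one
(`traceNorm_sub_inv_trace_smul_le`).

An arbitrary `C₁` is only tested on density matrices, so the exact flow must be known to stay among
them. Trace is conserved; positivity holds because the unnormalized scheme is positive and converges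
to the flow on refined grids, by the constant of (a) for general bounded initial values
(`IsLindbladSolution.isDensity`). -/

namespace LindbladFREM

open Set Filter Asymptotics

/-! ### Taylor expansion of the exact flow -/

section Flow

variable {F : Type*} [NormedAddCommGroup F] [NormedSpace ℝ F]

/-- Uniform first order Taylor bounds for a `C²` function on a compact interval. -/
theorem exists_uniform_taylor_bound {f : ℝ → F} {a b : ℝ} (hab : a < b)
    (hf : ContDiffOn ℝ 2 f (Icc a b)) :
    ∃ (f' : ℝ → F) (C : ℝ), 0 ≤ C ∧ (∀ x ∈ Icc a b, ‖f x‖ ≤ C) ∧ (∀ x ∈ Icc a b, ‖f' x‖ ≤ C) ∧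
      (∀ x ∈ Icc a b, ∀ y ∈ Icc a b, ‖f y - f x‖ ≤ C * |y - x|) ∧
      ∀ x ∈ Icc a b, ∀ y ∈ Icc a b, ‖f y - f x - (y - x) • f' x‖ ≤ C * |y - x| ^ 2 := by
  have hu : UniqueDiffOn ℝ (Icc a b) := uniqueDiffOn_Icc hab
  set f' := derivWithin f (Icc a b)
  have h1 : ContDiffOn ℝ 1 f' (Icc a b) := hf.derivWithin hu (by norm_num)
  have h2 : ContDiffOn ℝ 0 (derivWithin f' (Icc a b)) (Icc a b) := h1.derivWithin hu (by norm_num)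
  obtain ⟨C0, hC0⟩ := isCompact_Icc.exists_bound_of_continuousOn hf.continuousOn
  obtain ⟨C1, hC1⟩ := isCompact_Icc.exists_bound_of_continuousOn h1.continuousOn
  obtain ⟨C2, hC2⟩ := isCompact_Icc.exists_bound_of_continuousOn h2.continuousOn
  have ha : a ∈ Icc a b := left_mem_Icc.2 hab.le
  have hC0' : 0 ≤ C0 := (norm_nonneg _).trans (hC0 a ha)
  have hC1' : 0 ≤ C1 := (norm_nonneg _).trans (hC1 a ha)
  have hC2' : 0 ≤ C2 := (norm_nonneg _).trans (hC2 a ha)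
  have hd : DifferentiableOn ℝ f (Icc a b) := hf.differentiableOn (by norm_num)
  have hd' : DifferentiableOn ℝ f' (Icc a b) := h1.differentiableOn (by norm_num)
  have hlip : ∀ x ∈ Icc a b, ∀ y ∈ Icc a b, ‖f' y - f' x‖ ≤ C2 * |y - x| := fun x hx y hy =>
    (convex_Icc a b).norm_image_sub_le_of_norm_derivWithin_le hd' hC2 hx hy
  refine ⟨f', C0 + C1 + C2, by positivity, fun x hx => (hC0 x hx).trans (by linarith),
    fun x hx => (hC1 x hx).trans (by linarith), fun x hx y hy => ?_, fun x hx y hy => ?_⟩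
  · refine ((convex_Icc a b).norm_image_sub_le_of_norm_derivWithin_le hd hC1 hx hy).trans ?_
    exact mul_le_mul_of_nonneg_right (by linarith) (norm_nonneg _)
  · have hsub : uIcc x y ⊆ Icc a b := uIcc_subset_Icc hx hy
    -- Subtracting the affine part leaves the derivative `f' u - f' x`, of norm at most `C2 * |y -
    -- x|` between `x` and `y`; the mean value inequality supplies the second factor `|y - x|`.
    have key := (convex_uIcc x y).norm_image_sub_le_of_norm_hasDerivWithin_le (𝕜 := ℝ)
      (f := fun u => f u - (u - x) • f' x) (f' := fun u => f' u - (1 : ℝ) • f' x)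
      (C := C2 * |y - x|) (x := x) (y := y) (fun u hu' =>
        (((hd u (hsub hu')).hasDerivWithinAt).mono hsub).sub
          (((hasDerivWithinAt_id u _).sub_const x).smul_const (f' x)))
      (fun u hu' => by
        rw [one_smul]
        refine (hlip x hx u (hsub hu')).trans (mul_le_mul_of_nonneg_left ?_ hC2')
        exact abs_sub_left_of_mem_uIcc hu')
      left_mem_uIcc right_mem_uIcc
    have e : f y - f x - (y - x) • f' x
        = f y - (y - x) • f' x - (f x - (x - x) • f' x) := by simp; abel
    rw [e]
    refine key.trans ?_
    rw [Real.norm_eq_abs, mul_assoc, ← sq]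
    exact mul_le_mul_of_nonneg_right (by linarith) (by positivity)

theorem norm_le_of_linear_ode {Λ : ℝ → F →L[ℝ] F} {ρ : ℝ → F} {a b K : ℝ}
    (hK : ∀ u ∈ Icc a b, ‖Λ u‖ ≤ K)
    (hρ : ∀ u ∈ Icc a b, HasDerivWithinAt ρ (Λ u (ρ u)) (Icc a b) u) :
    ∀ u ∈ Icc a b, ‖ρ u‖ ≤ ‖ρ a‖ * Real.exp (K * (u - a)) := by
  intro u hu
  have := norm_le_gronwallBound_of_norm_deriv_right_le (f := ρ) (f' := fun u => Λ u (ρ u))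
    (δ := ‖ρ a‖) (K := K) (ε := 0) (a := a) (b := b)
    (fun x hx => (hρ x hx).continuousWithinAt)
    (fun x hx => (hρ x (Ico_subset_Icc_self hx)).mono_of_mem_nhdsWithin
      (Icc_mem_nhdsGE_of_mem hx)) le_rfl
    (fun x hx => by
      rw [add_zero]
      exact (Λ x).le_of_opNorm_le (hK x (Ico_subset_Icc_self hx)) _) u hu
  rwa [gronwallBound_ε0] at this

/-- Second order expansion, with coefficients frozen at the midpoint, of the solutions of a linear
equation with `C²` coefficients. -/
theorem exists_flow_expansion_bound {Λ : ℝ → F →L[ℝ] F} {T : ℝ} (hT : 0 < T)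
    (hΛ : ContDiffOn ℝ 2 Λ (Icc 0 T)) (M : ℝ) :
    ∃ C, ∀ (t τ : ℝ) (ρ : ℝ → F), 0 ≤ t → 0 ≤ τ → t + τ ≤ T →
      (∀ u ∈ Icc t (t + τ), HasDerivWithinAt ρ (Λ u (ρ u)) (Icc t (t + τ)) u) → ‖ρ t‖ ≤ M →
      ‖ρ (t + τ) - (ρ t + τ • Λ (t + τ / 2) (ρ t) +
        (τ ^ 2 / 2) • Λ (t + τ / 2) (Λ (t + τ / 2) (ρ t)))‖ ≤ C * τ ^ 3 := by
  obtain ⟨Λ', K, hK, hb, hb', hlip, htay⟩ := exists_uniform_taylor_bound hT hΛ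
  set R := M * Real.exp (K * T) with hR
  -- `R` bounds the solution by Grönwall. `D1` controls the variation of `ρ'` from the midpoint,
  -- `D2` the Euler half step from `t` to the midpoint, and `D3` the first order expansion of `ρ'`
  -- at the midpoint.
  set D1 := K * R + K * (K * R) with hD1
  set D2 := D1 + K * (K * R) with hD2
  set D3 := K * R + K * (K * R) + K * D1 with hD3
  refine ⟨D3 + K * D2, fun t τ ρ ht hτ htT hρ hM => ?_⟩
  have hM0 : 0 ≤ M := (norm_nonneg _).trans hM
  have hsub : Icc t (t + τ) ⊆ Icc 0 T := Icc_subset_Icc ht htT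
  have hR0 : 0 ≤ R := by positivity
  have hD10 : 0 ≤ D1 := by positivity
  have hbd : ∀ u ∈ Icc t (t + τ), ‖ρ u‖ ≤ R := fun u hu => by
    refine (norm_le_of_linear_ode (fun v hv => hb v (hsub hv)) hρ u hu).trans ?_
    have : u - t ≤ T := by linarith [hu.2]
    rw [hR]
    gcongr
  set s := t + τ / 2 with hs
  have hsI : s ∈ Icc t (t + τ) := ⟨by linarith, by linarith⟩
  have htI : t ∈ Icc t (t + τ) := ⟨by linarith, by linarith⟩
  have hτI : t + τ ∈ Icc t (t + τ) := ⟨by linarith, by linarith⟩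
  have habs : ∀ u ∈ Icc t (t + τ), |u - s| ≤ τ := fun u hu => by
    rw [abs_le]; constructor <;> linarith [hu.1, hu.2]
  have hder : ∀ u ∈ Icc t (t + τ), ‖Λ u (ρ u)‖ ≤ K * R := fun u hu =>
    (Λ u).le_of_opNorm_le_of_le (hb u (hsub hu)) (hbd u hu)
  have h1 : ∀ u ∈ Icc t (t + τ), ‖ρ u - ρ s‖ ≤ K * R * τ := fun u hu => by
    refine ((convex_Icc t (t + τ)).norm_image_sub_le_of_norm_hasDerivWithin_le hρ hder hsI
      hu).trans ?_
    rw [Real.norm_eq_abs]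
    exact mul_le_mul_of_nonneg_left (habs u hu) (by positivity)
  set Ls := Λ s with hLs
  have hLsb : ‖Ls‖ ≤ K := hb s (hsub hsI)
  have hLip : ∀ u ∈ Icc t (t + τ), ‖Λ u - Ls‖ ≤ K * τ := fun u hu =>
    (hlip s (hsub hsI) u (hsub hu)).trans (mul_le_mul_of_nonneg_left (habs u hu) hK)
  have h2 : ∀ u ∈ Icc t (t + τ), ‖Λ u (ρ u) - Ls (ρ s)‖ ≤ D1 * τ := fun u hu => by
    have e : Λ u (ρ u) - Ls (ρ s) = (Λ u - Ls) (ρ u) + Ls (ρ u - ρ s) := by simp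
    rw [e]
    refine (norm_add_le _ _).trans ?_
    have a1 := (Λ u - Ls).le_of_opNorm_le_of_le (hLip u hu) (hbd u hu)
    have a2 := Ls.le_of_opNorm_le_of_le hLsb (h1 u hu)
    calc _ ≤ K * τ * R + K * (K * R * τ) := add_le_add a1 a2
      _ = D1 * τ := by rw [hD1]; ring
  have h3 : ∀ u ∈ Icc t (t + τ), ‖ρ u - ρ s - (u - s) • Ls (ρ s)‖ ≤ D1 * τ ^ 2 := fun u hu => by
    have key := (convex_Icc t (t + τ)).norm_image_sub_le_of_norm_hasDerivWithin_le (𝕜 := ℝ)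
      (f := fun u => ρ u - (u - s) • Ls (ρ s)) (f' := fun u => Λ u (ρ u) - (1 : ℝ) • Ls (ρ s))
      (C := D1 * τ) (x := s) (y := u) (fun v hv => (hρ v hv).sub
        (((hasDerivWithinAt_id v _).sub_const s).smul_const _))
      (fun v hv => by rw [one_smul]; exact h2 v hv) hsI hu
    have e : ρ u - ρ s - (u - s) • Ls (ρ s)
        = ρ u - (u - s) • Ls (ρ s) - (ρ s - (s - s) • Ls (ρ s)) := by simp; abel
    rw [e]
    refine key.trans ?_
    rw [Real.norm_eq_abs, sq, ← mul_assoc]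
    exact mul_le_mul_of_nonneg_left (habs u hu) (by positivity)
  have h4 : ‖ρ s - ρ t - (τ / 2) • Ls (ρ t)‖ ≤ D2 * τ ^ 2 := by
    have e : ρ s - ρ t - (τ / 2) • Ls (ρ t)
        = -(ρ t - ρ s - (t - s) • Ls (ρ s)) - (τ / 2) • Ls (ρ t - ρ s) := by
      have : t - s = -(τ / 2) := by rw [hs]; ring
      rw [this, map_sub]; module
    rw [e]
    refine (norm_sub_le _ _).trans ?_
    rw [norm_neg, norm_smul, Real.norm_eq_abs, abs_of_nonneg (by linarith)]
    have a1 := h3 t htI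
    have a2 := Ls.le_of_opNorm_le_of_le hLsb (h1 t htI)
    calc _ ≤ D1 * τ ^ 2 + τ / 2 * (K * (K * R * τ)) := by gcongr
      _ ≤ D1 * τ ^ 2 + τ * (K * (K * R * τ)) := by gcongr; linarith
      _ = D2 * τ ^ 2 := by rw [hD2]; ring
  -- This is the second derivative of `ρ` at the midpoint, obtained by differentiating the equation.
  set b := Λ' s (ρ s) + Ls (Ls (ρ s)) with hbdef
  have h5 : ∀ u ∈ Icc t (t + τ), ‖Λ u (ρ u) - Ls (ρ s) - (u - s) • b‖ ≤ D3 * τ ^ 2 := by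
    intro u hu
    have e : Λ u (ρ u) - Ls (ρ s) - (u - s) • b = (Λ u - Ls - (u - s) • Λ' s) (ρ u)
        + (u - s) • Λ' s (ρ u - ρ s) + Ls (ρ u - ρ s - (u - s) • Ls (ρ s)) := by
      simp only [hbdef, map_sub, map_smul, _root_.sub_apply,
        _root_.smul_apply]
      module
    rw [e]
    refine (norm_add₃_le).trans ?_
    have a1 := (Λ u - Ls - (u - s) • Λ' s).le_of_opNorm_le_of_le
      ((htay s (hsub hsI) u (hsub hu)).trans (mul_le_mul_of_nonneg_left
        (pow_le_pow_left₀ (abs_nonneg _) (habs u hu) 2) hK)) (hbd u hu)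
    have a2 := (Λ' s).le_of_opNorm_le_of_le (hb' s (hsub hsI)) (h1 u hu)
    have a3 := Ls.le_of_opNorm_le_of_le hLsb (h3 u hu)
    rw [norm_smul, Real.norm_eq_abs]
    calc _ ≤ K * τ ^ 2 * R + τ * (K * (K * R * τ)) + K * (D1 * τ ^ 2) := by
          gcongr
          exact habs u hu
      _ = D3 * τ ^ 2 := by rw [hD3]; ring
  have h6 : ‖ρ (t + τ) - ρ t - τ • Ls (ρ s)‖ ≤ D3 * τ ^ 2 * τ := by
    -- The quadratic term takes equal values at `t` and `t + τ`, since `s` is the midpoint. It drops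
    -- out of the difference, and with it the only contribution of `Λ'`.
    have key := (convex_Icc t (t + τ)).norm_image_sub_le_of_norm_hasDerivWithin_le (𝕜 := ℝ)
      (f := fun u => ρ u - (u - s) • Ls (ρ s) - ((u - s) ^ 2 / 2) • b)
      (f' := fun u => Λ u (ρ u) - (1 : ℝ) • Ls (ρ s) - (u - s) • b)
      (C := D3 * τ ^ 2) (x := t) (y := t + τ) (fun v hv => by
        refine ((hρ v hv).sub (((hasDerivWithinAt_id v _).sub_const s).smul_const _)).sub ?_
        refine HasDerivWithinAt.smul_const ?_ b
        have := (((hasDerivAt_id v).sub_const s).pow 2).div_const 2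
        refine (this.congr_deriv ?_).hasDerivWithinAt
        simp)
      (fun v hv => by rw [one_smul]; exact h5 v hv) htI hτI
    have e : ρ (t + τ) - ρ t - τ • Ls (ρ s)
        = ρ (t + τ) - (t + τ - s) • Ls (ρ s) - ((t + τ - s) ^ 2 / 2) • b
          - (ρ t - (t - s) • Ls (ρ s) - ((t - s) ^ 2 / 2) • b) := by
      have a1 : t + τ - s = τ / 2 := by rw [hs]; ring
      have a2 : t - s = -(τ / 2) := by rw [hs]; ring
      rw [a1, a2]; module
    rw [e]
    refine key.trans ?_
    rw [Real.norm_eq_abs, add_sub_cancel_left, abs_of_nonneg hτ]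
  have e : ρ (t + τ) - (ρ t + τ • Ls (ρ t) + (τ ^ 2 / 2) • Ls (Ls (ρ t)))
      = (ρ (t + τ) - ρ t - τ • Ls (ρ s)) + τ • Ls (ρ s - ρ t - (τ / 2) • Ls (ρ t)) := by
    simp only [map_sub, map_smul]; module
  rw [e]
  refine (norm_add_le _ _).trans ?_
  have a1 := Ls.le_of_opNorm_le_of_le hLsb h4
  rw [norm_smul, Real.norm_eq_abs, abs_of_nonneg hτ]
  calc _ ≤ D3 * τ ^ 2 * τ + τ * (K * (D2 * τ ^ 2)) := by gcongr
    _ = _ := by ring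

end Flow

/-! ### Expansion of one step in a Banach algebra -/

section Scheme

variable {E : Type*} [NormedRing E] {ι : Type*} {l : Filter ι}

theorem isBigO_mul_sub_mul {f f' g g' : ι → E} {h : ι → ℝ}
    (hf : (fun i => f i - f' i) =O[l] h) (hg : (fun i => g i - g' i) =O[l] h)
    (hf' : f' =O[l] fun _ => (1 : ℝ)) (hgb : g =O[l] fun _ => (1 : ℝ)) :
    (fun i => f i * g i - f' i * g' i) =O[l] h := by
  have h1 : (fun i => (f i - f' i) * g i) =O[l] h := by simpa using hf.mul hgb
  have h2 : (fun i => f' i * (g i - g' i)) =O[l] h := by simpa using hf'.mul hg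
  refine (h1.add h2).congr_left fun i => ?_
  noncomm_ring

theorem isBigO_one_of_sub {f g : ι → E} {h : ι → ℝ} (hfg : (fun i => f i - g i) =O[l] h)
    (hg : g =O[l] fun _ => (1 : ℝ)) (hh : h =O[l] fun _ => (1 : ℝ)) :
    f =O[l] fun _ => (1 : ℝ) :=
  ((hfg.trans hh).add hg).congr_left fun i => by simp

variable [NormedAlgebra ℝ E]

theorem exists_exp_remainder_bound [CompleteSpace E] (r : ℝ) (n : ℕ) :
    ∃ C, ∀ x : E, ‖x‖ ≤ r →
      ‖NormedSpace.exp x - ∑ k ∈ Finset.range n, ((k.factorial : ℝ)⁻¹) • x ^ k‖ ≤ C * ‖x‖ ^ n := by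
  -- The approximation is available on open balls; the margin `1` puts the closed ball of radius `r`
  -- inside one.
  set r' : NNReal := Real.toNNReal (|r| + 1) with hr'
  have hr'v : (r' : ℝ) = |r| + 1 := Real.coe_toNNReal _ (by positivity)
  obtain ⟨a, -, C, -, h⟩ := (NormedSpace.exp_hasFPowerSeriesOnBall (𝕂 := ℝ)
    (𝔸 := E)).uniform_geometric_approx' (r' := r') ENNReal.coe_lt_top
  refine ⟨C * (a / r') ^ n, fun x hx => ?_⟩
  have hx' : x ∈ Metric.ball (0 : E) r' := by
    rw [mem_ball_zero_iff, hr'v]; linarith [le_abs_self r]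
  have := h x hx' n
  simp only [zero_add, FormalMultilinearSeries.partialSum, NormedSpace.expSeries_apply_eq] at this
  refine this.trans (le_of_eq ?_)
  rw [mul_assoc, ← mul_pow]
  ring

theorem isBigO_exp_sub [CompleteSpace E] {τ : ι → ℝ} {B : ι → E}
    (hτ : τ =O[l] fun _ => (1 : ℝ)) (hB : B =O[l] fun _ => (1 : ℝ)) (n : ℕ) :
    (fun i => NormedSpace.exp (τ i • B i) -
      ∑ k ∈ Finset.range n, ((k.factorial : ℝ)⁻¹) • (τ i • B i) ^ k) =O[l] fun i => τ i ^ n := by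
  have h1 : (fun i => τ i • B i) =O[l] fun _ => (1 : ℝ) := by simpa using hτ.smul hB
  have h2 : (fun i => τ i • B i) =O[l] τ := by simpa using (isBigO_refl τ l).smul hB
  obtain ⟨r, hr⟩ := h1.bound
  obtain ⟨C, hC⟩ := exists_exp_remainder_bound (E := E) r n
  refine IsBigO.trans (IsBigO.of_bound C ?_) (h2.norm_left.pow n)
  filter_upwards [hr] with i hi
  rw [norm_pow, norm_norm]
  exact hC _ (by simpa using hi)

theorem isBigO_clm_apply {J : ι → E →L[ℝ] E} {X : ι → E} {g h : ι → ℝ}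
    (hJ : J =O[l] g) (hX : X =O[l] h) : (fun i => J i (X i)) =O[l] fun i => g i * h i :=
  (IsBigO.of_norm_le fun i => (J i).le_opNorm (X i)).trans (hJ.norm_left.mul hX.norm_left)

/-- Second order expansion of one step of an exponential midpoint scheme in a Banach algebra. -/
theorem isBigO_scheme_sub [CompleteSpace E] {τ : ι → ℝ} {B B' G G' X : ι → E}
    {J J₁ : ι → E →L[ℝ] E} (hτ : τ =O[l] fun _ => (1 : ℝ))
    (hB : B =O[l] fun _ => (1 : ℝ)) (hB' : B' =O[l] fun _ => (1 : ℝ))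
    (hG : (fun i => G i - B i) =O[l] τ) (hG' : (fun i => G' i - B' i) =O[l] τ)
    (hX : X =O[l] fun _ => (1 : ℝ)) (hJ : J =O[l] fun _ => (1 : ℝ))
    (hJ₁ : (fun i => J₁ i - J i) =O[l] τ) :
    (fun i => NormedSpace.exp (τ i • B i) * X i * NormedSpace.exp (τ i • B' i) +
        τ i • (NormedSpace.exp ((τ i / 2) • B i) *
          J i (NormedSpace.exp ((τ i / 2) • G i) * (X i + (τ i / 2) • J₁ i (X i)) *
            NormedSpace.exp ((τ i / 2) • G' i)) * NormedSpace.exp ((τ i / 2) • B' i)) -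
      (X i + τ i • (B i * X i + X i * B' i + J i (X i)) +
        (τ i ^ 2 / 2) • (B i * (B i * X i + X i * B' i + J i (X i)) +
          (B i * X i + X i * B' i + J i (X i)) * B' i + J i (B i * X i + X i * B' i + J i (X i)))))
      =O[l] fun i => τ i ^ 3 := by
  have one : (fun _ => (1 : E)) =O[l] fun _ => (1 : ℝ) := isBigO_const_const _ one_ne_zero _
  have hτ2 : (fun i => τ i / 2) =O[l] fun _ => (1 : ℝ) := by
    simpa [div_eq_inv_mul] using hτ.const_mul_left (2⁻¹ : ℝ)
  have hhalf : (fun i => τ i / 2) =O[l] τ := by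
    simpa [div_eq_inv_mul] using (isBigO_refl τ l).const_mul_left (2⁻¹ : ℝ)
  have pow1 : ∀ n : ℕ, (fun i => τ i ^ n) =O[l] fun _ => (1 : ℝ) := fun n => by
    simpa using hτ.pow n
  -- boundedness of products, multiples and images
  have bm : ∀ {f g : ι → E}, f =O[l] (fun _ => (1 : ℝ)) → g =O[l] (fun _ => (1 : ℝ)) →
      (fun i => f i * g i) =O[l] fun _ => (1 : ℝ) := fun hf hg => by simpa using hf.mul hg
  have bs : ∀ {c : ι → ℝ} {g : ι → E}, c =O[l] (fun _ => (1 : ℝ)) → g =O[l] (fun _ => (1 : ℝ)) →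
      (fun i => c i • g i) =O[l] fun _ => (1 : ℝ) := fun hf hg => by simpa using hf.smul hg
  have bc : ∀ (c : ℝ) {g : ι → E}, g =O[l] (fun _ => (1 : ℝ)) →
      (fun i => c • g i) =O[l] fun _ => (1 : ℝ) := fun c _ hg => hg.const_smul_left c
  have bJ : ∀ {g : ι → E}, g =O[l] (fun _ => (1 : ℝ)) →
      (fun i => J i (g i)) =O[l] fun _ => (1 : ℝ) := fun hg => by simpa using isBigO_clm_apply hJ hg
  have rem : ∀ {n : ℕ} {Q : ι → E}, Q =O[l] (fun _ => (1 : ℝ)) →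
      (fun i => τ i ^ n • Q i) =O[l] fun i => τ i ^ n := fun {n Q} hQ => by
    simpa using (isBigO_refl (fun i => τ i ^ n) l).smul hQ
  have exp2 : ∀ {B : ι → E}, B =O[l] (fun _ => (1 : ℝ)) →
      (fun i => NormedSpace.exp ((τ i / 2) • B i) - (1 + (τ i / 2) • B i))
        =O[l] fun i => τ i ^ 2 := fun {B} hB => by
    refine ((isBigO_exp_sub hτ2 hB 2).trans (hhalf.pow 2)).congr_left fun i => ?_
    simp [Finset.sum_range_succ]
  have exp3 : ∀ {B : ι → E}, B =O[l] (fun _ => (1 : ℝ)) →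
      (fun i => NormedSpace.exp (τ i • B i) - (1 + τ i • B i + (τ i ^ 2 / 2) • (B i * B i)))
        =O[l] fun i => τ i ^ 3 := fun {B} hB => by
    refine (isBigO_exp_sub hτ hB 3).congr_left fun i => ?_
    simp [Finset.sum_range_succ, sq, smul_smul, div_eq_inv_mul]
  have lin : ∀ {B : ι → E}, B =O[l] (fun _ => (1 : ℝ)) →
      (fun i => 1 + (τ i / 2) • B i) =O[l] fun _ => (1 : ℝ) := fun hB => one.add (bs hτ2 hB)
  have quad : ∀ {B : ι → E}, B =O[l] (fun _ => (1 : ℝ)) →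
      (fun i => 1 + τ i • B i + (τ i ^ 2 / 2) • (B i * B i)) =O[l] fun _ => (1 : ℝ) := fun hB =>
    (one.add (bs hτ hB)).add (bs (by simpa [div_eq_inv_mul] using (pow1 2).const_mul_left 2⁻¹)
      (bm hB hB))
  have bexp2 : ∀ {B : ι → E}, B =O[l] (fun _ => (1 : ℝ)) →
      (fun i => NormedSpace.exp ((τ i / 2) • B i)) =O[l] fun _ => (1 : ℝ) := fun hB =>
    isBigO_one_of_sub (exp2 hB) (lin hB) (pow1 2)
  have bexp3 : ∀ {B : ι → E}, B =O[l] (fun _ => (1 : ℝ)) →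
      (fun i => NormedSpace.exp (τ i • B i)) =O[l] fun _ => (1 : ℝ) := fun hB =>
    isBigO_one_of_sub (exp3 hB) (quad hB) (pow1 3)
  have zero : ∀ {f : ι → E} {h : ι → ℝ}, (fun i => f i - f i) =O[l] h := fun {f h} => by
    simpa using isBigO_zero h l
  have hGb := isBigO_one_of_sub hG hB hτ
  have hGb' := isBigO_one_of_sub hG' hB' hτ
  have hJX := bJ hX
  have hJ₁X : (fun i => J₁ i (X i) - J i (X i)) =O[l] τ := by
    simpa using isBigO_clm_apply hJ₁ hX
  have hJ₁Xb := isBigO_one_of_sub hJ₁X hJX hτ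
  -- the no-jump part
  have first : (fun i => NormedSpace.exp (τ i • B i) * X i * NormedSpace.exp (τ i • B' i) -
      (X i + τ i • (B i * X i + X i * B' i) + (τ i ^ 2 / 2) • (B i * (B i * X i + X i * B' i) +
        (B i * X i + X i * B' i) * B' i))) =O[l] fun i => τ i ^ 3 := by
    have h1 := isBigO_mul_sub_mul (isBigO_mul_sub_mul (exp3 hB) (zero (f := X)) (quad hB) hX)
      (exp3 hB') (bm (quad hB) hX) (bexp3 hB')
    -- `Q` collects the terms of order three and four in the product of the two truncated
    -- exponentials around `X`; the terms up to order two are the claimed ones.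
    have h2 := rem (n := 3) (Q := fun i => (2⁻¹ : ℝ) • (B i * X i * (B' i * B' i) +
        B i * B i * X i * B' i) + τ i • ((4⁻¹ : ℝ) • (B i * B i * X i * (B' i * B' i))))
      ((bc _ ((bm (bm hB hX) (bm hB' hB')).add (bm (bm (bm hB hB) hX) hB'))).add
        (bs hτ (bc _ (bm (bm (bm hB hB) hX) (bm hB' hB')))))
    refine (h1.add h2).congr_left fun i => ?_
    simp only [mul_add, add_mul, smul_mul_assoc, mul_smul_comm, mul_assoc, one_mul, mul_one,
      smul_add]
    module
  -- the half step
  have half : (fun i => NormedSpace.exp ((τ i / 2) • G i) * (X i + (τ i / 2) • J₁ i (X i)) *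
      NormedSpace.exp ((τ i / 2) • G' i) - (X i + (τ i / 2) • (B i * X i + X i * B' i +
        J i (X i)))) =O[l] fun i => τ i ^ 2 := by
    have low : ∀ {f g : ι → E}, (fun i => f i - g i) =O[l] τ →
        (fun i => (τ i / 2) • f i - (τ i / 2) • g i) =O[l] fun i => τ i ^ 2 := fun h =>
      (hhalf.smul h).congr (fun i => smul_sub _ _ _) (fun i => by rw [smul_eq_mul, sq])
    have g1 : ∀ {G B : ι → E}, G =O[l] (fun _ => (1 : ℝ)) → (fun i => G i - B i) =O[l] τ →
        (fun i => NormedSpace.exp ((τ i / 2) • G i) - (1 + (τ i / 2) • B i))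
          =O[l] fun i => τ i ^ 2 := fun hG hGB =>
      ((exp2 hG).add (low hGB)).congr_left fun i => by abel
    have m : (fun i => X i + (τ i / 2) • J₁ i (X i) - (X i + (τ i / 2) • J i (X i)))
        =O[l] fun i => τ i ^ 2 := (low hJ₁X).congr_left fun i => by abel
    have mb := hX.add (bs hτ2 hJ₁Xb)
    have mb' := hX.add (bs hτ2 hJX)
    have h1 := isBigO_mul_sub_mul (isBigO_mul_sub_mul (g1 hGb hG) m (lin hB) mb)
      (g1 hGb' hG') (bm (lin hB) mb') (bexp2 hGb')
    have h2 := rem (n := 2) (Q := fun i => (4⁻¹ : ℝ) • (B i * X i * B' i + B i * J i (X i) +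
        J i (X i) * B' i) + τ i • ((8⁻¹ : ℝ) • (B i * J i (X i) * B' i)))
      ((bc _ (((bm (bm hB hX) hB').add (bm hB hJX)).add (bm hJX hB'))).add
        (bs hτ (bc _ (bm (bm hB hJX) hB'))))
    refine (h1.add h2).congr_left fun i => ?_
    simp only [mul_add, add_mul, smul_mul_assoc, mul_smul_comm, mul_assoc, one_mul, mul_one,
      smul_add]
    module
  -- the jump part
  have hΛX := ((bm hB hX).add (bm hX hB')).add hJX
  have hY₀ := hX.add (bs hτ2 hΛX)
  have hYb := isBigO_one_of_sub half hY₀ (pow1 2)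
  have hJY := (isBigO_clm_apply hJ half).congr (fun i => map_sub (J i) _ _) (fun i => one_mul _)
  have h1 := isBigO_mul_sub_mul (isBigO_mul_sub_mul (exp2 hB) hJY (lin hB) (bJ hYb))
      (exp2 hB') (bm (lin hB) (bJ hY₀)) (bexp2 hB')
  have hJΛ := bJ hΛX
  have h2 := rem (n := 2) (Q := fun i => (4⁻¹ : ℝ) • (B i * J i (X i) * B' i +
        B i * J i (B i * X i + X i * B' i + J i (X i)) +
        J i (B i * X i + X i * B' i + J i (X i)) * B' i) + τ i • ((8⁻¹ : ℝ) •
          (B i * J i (B i * X i + X i * B' i + J i (X i)) * B' i)))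
      ((bc _ (((bm (bm hB hJX) hB').add (bm hB hJΛ)).add (bm hJΛ hB'))).add
        (bs hτ (bc _ (bm (bm hB hJΛ) hB'))))
  have second := ((isBigO_refl τ l).smul (h1.add h2)).congr_right
    (g₂ := fun i => τ i ^ 3) fun i => by rw [smul_eq_mul]; ring
  refine (first.add second).congr_left fun i => ?_
  simp only [map_add, map_smul, mul_add, add_mul, smul_mul_assoc, mul_smul_comm, mul_assoc,
    one_mul, mul_one, smul_add]
  module

variable [CompleteSpace E]

/-- Third order local error of the exponential midpoint scheme for
`ρ' = A ρ + ρ A' + J ρ` in a Banach algebra. -/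
theorem exists_scheme_truncation_bound {A A' : ℝ → E} {J : ℝ → E →L[ℝ] E} {T : ℝ} (hT : 0 < T)
    (hA : ContDiffOn ℝ 2 A (Icc 0 T)) (hA' : ContDiffOn ℝ 2 A' (Icc 0 T))
    (hJ : ContDiffOn ℝ 2 J (Icc 0 T)) (M : ℝ) :
    ∃ C, ∀ (t τ : ℝ) (ρ : ℝ → E), 0 ≤ t → 0 ≤ τ → t + τ ≤ T →
      (∀ u ∈ Icc t (t + τ), HasDerivWithinAt ρ (A u * ρ u + ρ u * A' u + J u (ρ u))
        (Icc t (t + τ)) u) → ‖ρ t‖ ≤ M →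
      ‖ρ (t + τ) - (NormedSpace.exp (τ • A (t + τ / 2)) * ρ t *
          NormedSpace.exp (τ • A' (t + τ / 2)) +
        τ • (NormedSpace.exp ((τ / 2) • A (t + τ / 2)) *
          J (t + τ / 2) (NormedSpace.exp ((τ / 2) • A t) * (ρ t + (τ / 2) • J t (ρ t)) *
            NormedSpace.exp ((τ / 2) • A' t)) * NormedSpace.exp ((τ / 2) • A' (t + τ / 2))))‖
        ≤ C * τ ^ 3 := by
  set Λ : ℝ → E →L[ℝ] E := fun u =>
    ContinuousLinearMap.mul ℝ E (A u) + (ContinuousLinearMap.mul ℝ E).flip (A' u) + J u with hΛdef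
  have hΛ : ContDiffOn ℝ 2 Λ (Icc 0 T) :=
    (((ContinuousLinearMap.mul ℝ E).contDiff.comp_contDiffOn hA).add
      ((ContinuousLinearMap.mul ℝ E).flip.contDiff.comp_contDiffOn hA')).add hJ
  have hΛa : ∀ u x, Λ u x = A u * x + x * A' u + J u x := fun u x => by simp [hΛdef]
  obtain ⟨C₁, hC₁⟩ := exists_flow_expansion_bound hT hΛ M
  obtain ⟨-, a, -, ha, -, ha', -⟩ := exists_uniform_taylor_bound hT hA
  obtain ⟨-, b, -, hb, -, hb', -⟩ := exists_uniform_taylor_bound hT hA'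
  obtain ⟨-, c, -, hc, -, hc', -⟩ := exists_uniform_taylor_bound hT hJ
  -- A big-O along the principal filter of `S` is a bound on all of `S` with one constant, hence
  -- uniform in time, step size and initial value.
  set S : Set (ℝ × ℝ × E) := {p | 0 ≤ p.1 ∧ 0 ≤ p.2.1 ∧ p.1 + p.2.1 ≤ T ∧ ‖p.2.2‖ ≤ M}
  have hS1 : ∀ p ∈ S, p.1 ∈ Icc 0 T := fun p hp => ⟨hp.1, by linarith [hp.2.1, hp.2.2.1]⟩
  have hS2 : ∀ p ∈ S, p.1 + p.2.1 / 2 ∈ Icc 0 T := fun p hp =>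
    ⟨by linarith [hp.1, hp.2.1], by linarith [hp.2.1, hp.2.2.1]⟩
  have bdd : ∀ {G : Type _} [NormedAddCommGroup G] {f : ℝ → G} {k : ℝ},
      (∀ u ∈ Icc 0 T, ‖f u‖ ≤ k) → (fun p : ℝ × ℝ × E => f (p.1 + p.2.1 / 2))
        =O[𝓟 S] fun _ => (1 : ℝ) := fun {G _ f k} h =>
    isBigO_principal.2 ⟨k, fun p hp => by simpa using h _ (hS2 p hp)⟩
  have lip : ∀ {G : Type _} [NormedAddCommGroup G] {f : ℝ → G} {k : ℝ},
      (∀ x ∈ Icc 0 T, ∀ y ∈ Icc 0 T, ‖f y - f x‖ ≤ k * |y - x|) →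
      (fun p : ℝ × ℝ × E => f p.1 - f (p.1 + p.2.1 / 2)) =O[𝓟 S] fun p => p.2.1 :=
    fun {G _ f k} h => by
      have h1 : (fun p : ℝ × ℝ × E => f p.1 - f (p.1 + p.2.1 / 2)) =O[𝓟 S] fun p => p.2.1 / 2 :=
        isBigO_principal.2 ⟨k, fun p hp => by
          have := h _ (hS2 p hp) _ (hS1 p hp)
          rwa [sub_add_cancel_left, abs_neg] at this⟩
      refine h1.trans ?_
      simpa [div_eq_inv_mul] using
        (isBigO_refl (fun p : ℝ × ℝ × E => p.2.1) (𝓟 S)).const_mul_left (2⁻¹ : ℝ)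
  have key := isBigO_scheme_sub (l := 𝓟 S) (τ := fun p => p.2.1)
    (B := fun p => A (p.1 + p.2.1 / 2)) (B' := fun p => A' (p.1 + p.2.1 / 2))
    (G := fun p => A p.1) (G' := fun p => A' p.1) (X := fun p => p.2.2)
    (J := fun p => J (p.1 + p.2.1 / 2)) (J₁ := fun p => J p.1)
    (isBigO_principal.2 ⟨T, fun p hp => by
      rw [Real.norm_eq_abs, abs_of_nonneg hp.2.1]; simpa using by linarith [hp.1, hp.2.2.1]⟩)
    (bdd ha) (bdd hb) (lip ha') (lip hb')
    (isBigO_principal.2 ⟨M, fun p hp => by simpa using hp.2.2.2⟩) (bdd hc) (lip hc')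
  obtain ⟨C₂, hC₂⟩ := isBigO_principal.1 key
  refine ⟨C₁ + C₂, fun t τ ρ ht hτ htT hρ hM => ?_⟩
  have h1 := hC₁ t τ ρ ht hτ htT (fun u hu => by rw [hΛa]; exact hρ u hu) hM
  have h2 := hC₂ (t, τ, ρ t) ⟨ht, hτ, htT, hM⟩
  simp only [hΛa] at h1
  rw [norm_pow, Real.norm_eq_abs, abs_of_nonneg hτ] at h2
  rw [add_mul]
  refine le_trans ?_ (add_le_add h1 h2)
  rw [norm_sub_rev (NormedSpace.exp _ * _ * _ + _)]
  exact norm_sub_le_norm_sub_add_norm_sub _ _ _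

end Scheme

end LindbladFREM

namespace LindbladFREM

/-! ### The trace norm through its duality with the operator norm -/

section TraceNorm

open scoped Matrix.Norms.L2Operator
open Matrix

variable {m : ℕ}

theorem trace_eq_sum_inner (X : Matrix (Fin m) (Fin m) ℂ)
    (b : OrthonormalBasis (Fin m) ℂ (EuclideanSpace ℂ (Fin m))) :
    X.trace = ∑ j, inner ℂ (b j) (toEuclideanCLM (𝕜 := ℂ) X (b j)) := by
  rw [← Matrix.trace_toLin_eq X (PiLp.basisFun 2 ℂ (Fin m)), LinearMap.trace_eq_sum_inner _ b]
  rfl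

theorem toEuclideanCLM_eigenvectorBasis {X : Matrix (Fin m) (Fin m) ℂ} (hX : X.IsHermitian)
    (j : Fin m) : toEuclideanCLM (𝕜 := ℂ) X (hX.eigenvectorBasis j) =
      (hX.eigenvalues j : ℂ) • hX.eigenvectorBasis j := by
  ext i
  simpa using congrFun (hX.mulVec_eigenvectorBasis j) i

theorem norm_toEuclideanCLM_eigenvectorBasis (X : Matrix (Fin m) (Fin m) ℂ) (j : Fin m) :
    ‖toEuclideanCLM (𝕜 := ℂ) X
      ((isHermitian_conjTranspose_mul_self X).eigenvectorBasis j)‖ =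
      Real.sqrt ((isHermitian_conjTranspose_mul_self X).eigenvalues j) := by
  set hX := isHermitian_conjTranspose_mul_self X
  set v := hX.eigenvectorBasis j
  have h : toEuclideanCLM (𝕜 := ℂ) (Xᴴ * X) v = (hX.eigenvalues j : ℂ) • v :=
    toEuclideanCLM_eigenvectorBasis hX j
  have hn : ‖v‖ = 1 := hX.eigenvectorBasis.orthonormal.1 j
  generalize hX.eigenvalues j = c at h ⊢
  clear_value v
  rw [← Matrix.star_eq_conjTranspose, map_mul, map_star] at h
  have h2 := ContinuousLinearMap.apply_norm_sq_eq_inner_adjoint_right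
    (toEuclideanCLM (𝕜 := ℂ) X) v
  rw [← ContinuousLinearMap.star_eq_adjoint, ← ContinuousLinearMap.mul_def, h, inner_smul_right,
    inner_self_eq_norm_sq_to_K, hn] at h2
  rw [← Real.sqrt_sq (norm_nonneg _), h2]
  simp

theorem traceNorm_nonneg (X : Matrix (Fin m) (Fin m) ℂ) : 0 ≤ traceNorm X :=
  Finset.sum_nonneg fun _ _ => Real.sqrt_nonneg _

theorem norm_inner_toEuclideanCLM_le (W : Matrix (Fin m) (Fin m) ℂ)
    {v : EuclideanSpace ℂ (Fin m)} (hv : ‖v‖ = 1) (w : EuclideanSpace ℂ (Fin m)) :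
    ‖inner ℂ v (toEuclideanCLM (𝕜 := ℂ) W w)‖ ≤ ‖W‖ * ‖w‖ := by
  refine (norm_inner_le_norm _ _).trans ?_
  rw [hv, one_mul, ← l2_opNorm_toEuclideanCLM]
  exact ContinuousLinearMap.le_opNorm _ _

/-- Taking the trace in an eigenbasis `v j` of `X† X`, each term is at most `‖W‖ ‖X v j‖`, and `‖X v
j‖` is a singular value. -/
theorem norm_trace_mul_le (W X : Matrix (Fin m) (Fin m) ℂ) :
    ‖(W * X).trace‖ ≤ ‖W‖ * traceNorm X := by
  set hX := isHermitian_conjTranspose_mul_self X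
  rw [trace_eq_sum_inner (W * X) hX.eigenvectorBasis, traceNorm, Finset.mul_sum]
  refine (norm_sum_le _ _).trans (Finset.sum_le_sum fun j _ => ?_)
  rw [map_mul, mul_apply_eq_comp, ← norm_toEuclideanCLM_eigenvectorBasis]
  exact norm_inner_toEuclideanCLM_le W (hX.eigenvectorBasis.orthonormal.1 j) _

theorem exists_conjTranspose_mul_self_eq (X : Matrix (Fin m) (Fin m) ℂ) :
    ∃ (U : unitary (Matrix (Fin m) (Fin m) ℂ)) (σ : Fin m → ℝ), (∀ j, 0 ≤ σ j) ∧
      Xᴴ * X = (U : Matrix (Fin m) (Fin m) ℂ) * diagonal (fun j => (σ j : ℂ)) *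
        star (U : Matrix (Fin m) (Fin m) ℂ) ∧ traceNorm X = ∑ j, Real.sqrt (σ j) := by
  refine ⟨(isHermitian_conjTranspose_mul_self X).eigenvectorUnitary,
    (isHermitian_conjTranspose_mul_self X).eigenvalues,
    eigenvalues_conjTranspose_mul_self_nonneg X, ?_, rfl⟩
  conv_lhs => rw [(isHermitian_conjTranspose_mul_self X).spectral_theorem]
  rw [Unitary.conjStarAlgAut_apply]
  rfl

/-- The trace norm is attained in the duality with the operator norm. -/
theorem exists_trace_mul_eq_traceNorm (X : Matrix (Fin m) (Fin m) ℂ) :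
    ∃ W : Matrix (Fin m) (Fin m) ℂ, ‖W‖ ≤ 1 ∧ (W * X).trace = traceNorm X := by
  obtain ⟨U, σ, hnn, hs, htr⟩ := exists_conjTranspose_mul_self_eq X
  -- Inverses of zero are zero, so `D` is the pseudo-inverse of `√(X† X)` in its eigenbasis, and the
  -- witness `U D U† X†` is the adjoint of the partial isometry in the polar decomposition of `X`.
  set D : Matrix (Fin m) (Fin m) ℂ :=
    diagonal fun j => ((Real.sqrt (σ j))⁻¹ : ℂ) with hD
  have hUU : star (U : Matrix (Fin m) (Fin m) ℂ) * U = 1 := Unitary.coe_star_mul_self U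
  have hsq : ∀ j, (Real.sqrt (σ j) : ℂ) * Real.sqrt (σ j) =
      σ j := fun j => by
    rw [← Complex.ofReal_mul, Real.mul_self_sqrt (hnn j)]
  refine ⟨U * D * star (U : Matrix (Fin m) (Fin m) ℂ) * Xᴴ, ?_, ?_⟩
  · have h1 : (U * D * star (U : Matrix (Fin m) (Fin m) ℂ) * Xᴴ) *
        star (U * D * star (U : Matrix (Fin m) (Fin m) ℂ) * Xᴴ) =
        U * (D * diagonal (fun j => (σ j : ℂ)) * star D) *
          star (U : Matrix (Fin m) (Fin m) ℂ) := by
      simp only [star_mul, star_star, ← star_eq_conjTranspose]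
      rw [← star_eq_conjTranspose] at hs
      calc _ = U * D * star (U : Matrix (Fin m) (Fin m) ℂ) * (star X * X) *
            (U * star D * star (U : Matrix (Fin m) (Fin m) ℂ)) := by noncomm_ring
        _ = U * D * (star (U : Matrix (Fin m) (Fin m) ℂ) * U) *
            diagonal (fun j => (σ j : ℂ)) *
            (star (U : Matrix (Fin m) (Fin m) ℂ) * U) * star D *
            star (U : Matrix (Fin m) (Fin m) ℂ) := by rw [hs]; noncomm_ring
        _ = _ := by rw [hUU]; noncomm_ring
    have h2 : ‖U * D * star (U : Matrix (Fin m) (Fin m) ℂ) * Xᴴ‖ ^ 2 ≤ 1 := by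
      rw [sq, ← CStarRing.norm_self_mul_star, h1, ← Unitary.coe_star,
        CStarRing.norm_mul_coe_unitary, CStarRing.norm_coe_unitary_mul, hD, star_eq_conjTranspose,
        diagonal_conjTranspose, diagonal_mul_diagonal, diagonal_mul_diagonal, l2_opNorm_diagonal]
      refine (pi_norm_le_iff_of_nonneg zero_le_one).2 fun j => ?_
      simp only [Pi.star_apply, star_inv₀, ← hsq]
      rcases eq_or_ne (Real.sqrt (σ j) : ℂ) 0 with h | h
      · simp [h]
      · have : star (Real.sqrt (σ j) : ℂ) = Real.sqrt (σ j) :=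
          Complex.conj_ofReal _
        rw [this]
        field_simp
        simp
    exact (sq_le_one_iff₀ (norm_nonneg _)).1 h2
  · have h1 : U * D * star (U : Matrix (Fin m) (Fin m) ℂ) * Xᴴ * X =
        U * (D * diagonal (fun j => (σ j : ℂ)) *
          star (U : Matrix (Fin m) (Fin m) ℂ)) := by
      calc _ = U * D * star (U : Matrix (Fin m) (Fin m) ℂ) * (Xᴴ * X) := by noncomm_ring
        _ = U * D * (star (U : Matrix (Fin m) (Fin m) ℂ) * U) *
            diagonal (fun j => (σ j : ℂ)) *
            star (U : Matrix (Fin m) (Fin m) ℂ) := by rw [hs]; noncomm_ring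
        _ = _ := by rw [hUU]; noncomm_ring
    rw [h1, trace_mul_comm, mul_assoc, hUU, mul_one, hD, diagonal_mul_diagonal, trace_diagonal,
      htr, Complex.ofReal_sum]
    refine Finset.sum_congr rfl fun j _ => ?_
    rw [← hsq]
    rcases eq_or_ne (Real.sqrt (σ j) : ℂ) 0 with h | h
    · simp [h]
    · rw [inv_mul_cancel_left₀ h]

/-- The form in which duality is used: subadditivity and the ideal property of the trace norm reduce
to linear estimates of `Tr (W X)`. -/
theorem traceNorm_le_of_forall {X : Matrix (Fin m) (Fin m) ℂ} {c : ℝ}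
    (h : ∀ W : Matrix (Fin m) (Fin m) ℂ, ‖W‖ ≤ 1 → ‖(W * X).trace‖ ≤ c) : traceNorm X ≤ c := by
  obtain ⟨W, hW, hWX⟩ := exists_trace_mul_eq_traceNorm X
  have := h W hW
  rwa [hWX, Complex.norm_real, Real.norm_of_nonneg (traceNorm_nonneg X)] at this

theorem norm_trace_mul_le_of_norm_le_one {W : Matrix (Fin m) (Fin m) ℂ} (hW : ‖W‖ ≤ 1)
    (X : Matrix (Fin m) (Fin m) ℂ) : ‖(W * X).trace‖ ≤ traceNorm X :=
  (norm_trace_mul_le W X).trans (mul_le_of_le_one_left (traceNorm_nonneg X) hW)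

/-- Equality fails for `m = 0`, which is allowed. -/
theorem l2_opNorm_one_le : ‖(1 : Matrix (Fin m) (Fin m) ℂ)‖ ≤ 1 := by
  rw [← diagonal_one, l2_opNorm_diagonal]
  exact (pi_norm_le_iff_of_nonneg zero_le_one).2 fun j => by simp

theorem norm_trace_le (X : Matrix (Fin m) (Fin m) ℂ) : ‖X.trace‖ ≤ traceNorm X := by
  simpa using norm_trace_mul_le_of_norm_le_one l2_opNorm_one_le X

theorem traceNorm_add_le (X Y : Matrix (Fin m) (Fin m) ℂ) :
    traceNorm (X + Y) ≤ traceNorm X + traceNorm Y :=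
  traceNorm_le_of_forall fun W hW => by
    rw [mul_add, trace_add]
    exact norm_add_le_of_le (norm_trace_mul_le_of_norm_le_one hW X)
      (norm_trace_mul_le_of_norm_le_one hW Y)

theorem traceNorm_smul_le (c : ℂ) (X : Matrix (Fin m) (Fin m) ℂ) :
    traceNorm (c • X) ≤ ‖c‖ * traceNorm X :=
  traceNorm_le_of_forall fun W hW => by
    rw [mul_smul_comm, trace_smul, norm_smul]
    exact mul_le_mul_of_nonneg_left (norm_trace_mul_le_of_norm_le_one hW X) (norm_nonneg _)

theorem traceNorm_zero : traceNorm (0 : Matrix (Fin m) (Fin m) ℂ) = 0 :=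
  le_antisymm (traceNorm_le_of_forall fun W _ => by simp) (traceNorm_nonneg _)

theorem traceNorm_sum_le {ι : Type*} (s : Finset ι) (X : ι → Matrix (Fin m) (Fin m) ℂ) :
    traceNorm (∑ i ∈ s, X i) ≤ ∑ i ∈ s, traceNorm (X i) :=
  Finset.le_sum_of_subadditive traceNorm traceNorm_zero.le traceNorm_add_le s X

theorem traceNorm_mul_mul_le (U X V : Matrix (Fin m) (Fin m) ℂ) :
    traceNorm (U * X * V) ≤ ‖U‖ * ‖V‖ * traceNorm X :=
  traceNorm_le_of_forall fun W hW => by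
    have e : (W * (U * X * V)).trace = (V * W * U * X).trace := by
      rw [← mul_assoc, trace_mul_comm]; simp only [mul_assoc]
    rw [e]
    refine (norm_trace_mul_le _ X).trans (mul_le_mul_of_nonneg_right ?_ (traceNorm_nonneg X))
    calc ‖V * W * U‖ ≤ ‖V‖ * ‖W‖ * ‖U‖ :=
          (norm_mul_le _ _).trans (mul_le_mul_of_nonneg_right (norm_mul_le _ _) (norm_nonneg _))
      _ ≤ ‖V‖ * 1 * ‖U‖ := by gcongr
      _ = ‖U‖ * ‖V‖ := by ring

theorem l2_opNorm_le_traceNorm (X : Matrix (Fin m) (Fin m) ℂ) : ‖X‖ ≤ traceNorm X := by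
  obtain ⟨U, σ, hnn, hs, htr⟩ := exists_conjTranspose_mul_self_eq X
  have h : ‖X‖ ^ 2 ≤ traceNorm X ^ 2 := by
    rw [sq, ← CStarRing.norm_star_mul_self, star_eq_conjTranspose, hs,
      ← Unitary.coe_star, CStarRing.norm_mul_coe_unitary, CStarRing.norm_coe_unitary_mul,
      l2_opNorm_diagonal]
    refine (pi_norm_le_iff_of_nonneg (by positivity)).2 fun j => ?_
    rw [Complex.norm_real, Real.norm_of_nonneg (hnn j), ← Real.sq_sqrt (hnn j), htr]
    exact pow_le_pow_left₀ (Real.sqrt_nonneg _) (Finset.single_le_sum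
      (f := fun j => Real.sqrt (σ j)) (fun _ _ => Real.sqrt_nonneg _) (Finset.mem_univ j)) 2
  exact (sq_le_sq₀ (norm_nonneg _) (traceNorm_nonneg X)).1 h

theorem traceNorm_le_mul_l2_opNorm (X : Matrix (Fin m) (Fin m) ℂ) : traceNorm X ≤ m * ‖X‖ := by
  calc traceNorm X ≤ ∑ _j : Fin m, ‖X‖ := Finset.sum_le_sum fun j _ => by
        rw [← norm_toEuclideanCLM_eigenvectorBasis, ← l2_opNorm_toEuclideanCLM X]
        refine (ContinuousLinearMap.le_opNorm _ _).trans_eq ?_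
        rw [(isHermitian_conjTranspose_mul_self X).eigenvectorBasis.orthonormal.1 j, mul_one]
    _ = m * ‖X‖ := by simp

/-- In an eigenbasis of `X` itself, `Tr (W X)` is a sum of eigenvalues weighted by numbers of
modulus at most one. -/
theorem traceNorm_le_of_posSemidef {X : Matrix (Fin m) (Fin m) ℂ} (hX : X.PosSemidef) :
    traceNorm X ≤ ‖X.trace‖ := by
  refine traceNorm_le_of_forall fun W hW => ?_
  have hH := hX.isHermitian
  have htr : ‖X.trace‖ = ∑ j, hH.eigenvalues j := by
    rw [hH.trace_eq_sum_eigenvalues]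
    norm_cast
    exact abs_of_nonneg (Finset.sum_nonneg fun j _ => hX.eigenvalues_nonneg j)
  rw [htr, trace_eq_sum_inner (W * X) hH.eigenvectorBasis]
  refine (norm_sum_le _ _).trans (Finset.sum_le_sum fun j _ => ?_)
  rw [map_mul, mul_apply_eq_comp, toEuclideanCLM_eigenvectorBasis, map_smul,
    inner_smul_right, norm_mul, Complex.norm_real, Real.norm_of_nonneg (hX.eigenvalues_nonneg j)]
  refine mul_le_of_le_one_right (hX.eigenvalues_nonneg j) ?_
  refine (norm_inner_toEuclideanCLM_le W (hH.eigenvectorBasis.orthonormal.1 j) _).trans ?_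
  rwa [hH.eigenvectorBasis.orthonormal.1 j, mul_one]

theorem IsDensity.traceNorm_le {X : Matrix (Fin m) (Fin m) ℂ} (hX : IsDensity X) :
    traceNorm X ≤ 1 := by
  simpa [hX.2] using traceNorm_le_of_posSemidef hX.1

end TraceNorm

end LindbladFREM

namespace LindbladFREM

open Set
open scoped Matrix.Norms.L2Operator
open Matrix

/-! ### Dissipative matrices generate contractions -/

section Contraction

variable {m : ℕ}

theorem re_inner_toEuclideanCLM_nonpos {B : Matrix (Fin m) (Fin m) ℂ}
    (hB : (-(B + Bᴴ)).PosSemidef) (y : EuclideanSpace ℂ (Fin m)) :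
    (inner ℂ y (toEuclideanCLM (𝕜 := ℂ) B y)).re ≤ 0 := by
  have h1 := (posSemidef_iff_dotProduct_mulVec.1 hB).2 y.ofLp
  have h2 : star y.ofLp ⬝ᵥ (-(B + Bᴴ)) *ᵥ y.ofLp =
      inner ℂ y (toEuclideanCLM (𝕜 := ℂ) (-(B + Bᴴ)) y) := by
    rw [EuclideanSpace.inner_eq_star_dotProduct, dotProduct_comm]
    rfl
  rw [h2, ← star_eq_conjTranspose, map_neg, map_add, map_star, _root_.neg_apply, _root_.add_apply,
    inner_neg_right, inner_add_right, ContinuousLinearMap.star_eq_adjoint,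
    ContinuousLinearMap.adjoint_inner_right, ← inner_conj_symm _ y] at h1
  generalize inner ℂ y (toEuclideanCLM (𝕜 := ℂ) B y) = z at h1 ⊢
  have h3 := (Complex.le_def.1 h1).1
  rw [Complex.zero_re, Complex.neg_re, Complex.add_re, Complex.conj_re] at h3
  linarith

/-- The semigroup of a dissipative matrix is a contraction in operator norm. -/
theorem l2_opNorm_exp_smul_le_one {B : Matrix (Fin m) (Fin m) ℂ}
    (hB : (-(B + Bᴴ)).PosSemidef) {τ : ℝ} (hτ : 0 ≤ τ) :
    ‖NormedSpace.exp ((τ : ℂ) • B)‖ ≤ 1 := by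
  rw [← l2_opNorm_toEuclideanCLM]
  refine ContinuousLinearMap.opNorm_le_bound _ zero_le_one fun x => ?_
  let ev : Matrix (Fin m) (Fin m) ℂ →ₗ[ℝ] EuclideanSpace ℂ (Fin m) :=
    { toFun := fun X => toEuclideanCLM (𝕜 := ℂ) X x
      map_add' := fun X Y => by rw [map_add, _root_.add_apply]
      map_smul' := fun c X => by
        rw [← Complex.coe_smul, map_smul, _root_.smul_apply, RingHom.id_apply, Complex.coe_smul] }
  have hd : ∀ t : ℝ, HasDerivAt
      (fun t : ℝ => toEuclideanCLM (𝕜 := ℂ) (NormedSpace.exp (t • B)) x)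
      (toEuclideanCLM (𝕜 := ℂ) B (toEuclideanCLM (𝕜 := ℂ) (NormedSpace.exp (t • B)) x)) t := by
    intro t
    have := (LinearMap.toContinuousLinearMap ev).hasFDerivAt.comp_hasDerivAt t
      (hasDerivAt_exp_smul_const' (𝕂 := ℝ) B t)
    refine this.congr_deriv ?_
    change toEuclideanCLM (𝕜 := ℂ) (B * NormedSpace.exp (t • B)) x = _
    rw [map_mul, mul_apply_eq_comp]
  have hanti : Antitone
      (fun t : ℝ => ‖toEuclideanCLM (𝕜 := ℂ) (NormedSpace.exp (t • B)) x‖ ^ 2) := by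
    -- Along `y(t) = e^{tB} x`, the derivative of `‖y‖²` is `2 Re ⟨y, B y⟩ ≤ 0`.
    refine antitone_of_hasDerivAt_nonpos (fun t => (hd t).norm_sq) fun t => ?_
    have hre : ∀ a b : EuclideanSpace ℂ (Fin m), inner ℝ a b = (inner ℂ a b).re := fun a b => by
      simp [PiLp.inner_apply]
    rw [hre]
    have := re_inner_toEuclideanCLM_nonpos hB
      (toEuclideanCLM (𝕜 := ℂ) (NormedSpace.exp (t • B)) x)
    exact mul_nonpos_of_nonneg_of_nonpos zero_le_two this
  have h := hanti hτ
  simp only [zero_smul, NormedSpace.exp_zero, map_one, one_apply_eq_self] at h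
  rw [one_mul, Complex.coe_smul]
  exact (sq_le_sq₀ (norm_nonneg _) (norm_nonneg _)).1 h

end Contraction

/-! ### From entrywise to matrix-valued regularity -/

section Regularity

variable {m : ℕ}

theorem eq_sum_toSpanSingleton_single (X : Matrix (Fin m) (Fin m) ℂ) :
    X = ∑ i, ∑ j, ((ContinuousLinearMap.toSpanSingleton ℂ
      (single i j (1 : ℂ))).restrictScalars ℝ) (X i j) := by
  conv_lhs => rw [matrix_eq_sum_single X]
  simp [smul_single]

theorem contDiffOn_of_entries {f : ℝ → Matrix (Fin m) (Fin m) ℂ} {s : Set ℝ} {n : WithTop ℕ∞}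
    (h : ∀ i j, ContDiffOn ℝ n (fun t => f t i j) s) : ContDiffOn ℝ n f s := by
  have : f = fun t => ∑ i, ∑ j, ((ContinuousLinearMap.toSpanSingleton ℂ
      (single i j (1 : ℂ))).restrictScalars ℝ) (f t i j) :=
    funext fun t => eq_sum_toSpanSingleton_single (f t)
  rw [this]
  exact ContDiffOn.sum fun i _ => ContDiffOn.sum fun j _ =>
    (ContinuousLinearMap.contDiff _).comp_contDiffOn (h i j)

theorem hasDerivWithinAt_of_entries {f : ℝ → Matrix (Fin m) (Fin m) ℂ}
    {f' : Matrix (Fin m) (Fin m) ℂ} {s : Set ℝ} {t : ℝ}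
    (h : ∀ i j, HasDerivWithinAt (fun t => f t i j) (f' i j) s t) : HasDerivWithinAt f f' s t := by
  have : f = fun t => ∑ i, ∑ j, ((ContinuousLinearMap.toSpanSingleton ℂ
      (single i j (1 : ℂ))).restrictScalars ℝ) (f t i j) :=
    funext fun t => eq_sum_toSpanSingleton_single (f t)
  rw [this, eq_sum_toSpanSingleton_single f']
  exact HasDerivWithinAt.fun_sum fun i _ => HasDerivWithinAt.fun_sum fun j _ =>
    (ContinuousLinearMap.hasFDerivAt _).comp_hasDerivWithinAt t (h i j)

end Regularity

/-! ### Algebra and positivity of one step -/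

section Step

variable {m K : ℕ}

/-- The jump part `X ↦ ∑ₖ gₖ Lₖ X Lₖ†` of the Lindblad generator. -/
noncomputable def jump (L : Fin K → Matrix (Fin m) (Fin m) ℂ) (g : Fin K → ℝ) :
    Matrix (Fin m) (Fin m) ℂ →ₗ[ℂ] Matrix (Fin m) (Fin m) ℂ where
  toFun X := ∑ k, (g k : ℂ) • (L k * X * (L k)ᴴ)
  map_add' X Y := by simp [mul_add, add_mul, Finset.sum_add_distrib]
  map_smul' c X := by simp [Finset.smul_sum, smul_comm c]

theorem jump_apply (L : Fin K → Matrix (Fin m) (Fin m) ℂ) (g : Fin K → ℝ)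
    (X : Matrix (Fin m) (Fin m) ℂ) : jump L g X = ∑ k, (g k : ℂ) • (L k * X * (L k)ᴴ) := rfl

variable (H : ℝ → Matrix (Fin m) (Fin m) ℂ) (L : Fin K → Matrix (Fin m) (Fin m) ℂ)
  (γ : Fin K → ℝ → ℝ)

theorem fremStep_eq (τ t : ℝ) (X : Matrix (Fin m) (Fin m) ℂ) :
    fremStep H L γ τ t X =
      NormedSpace.exp ((τ : ℂ) • generator H L γ (t + τ / 2)) * X *
        NormedSpace.exp ((τ : ℂ) • (generator H L γ (t + τ / 2))ᴴ) +
      (τ : ℂ) • (NormedSpace.exp (((τ / 2 : ℝ) : ℂ) • generator H L γ (t + τ / 2)) *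
        jump L (fun k => γ k (t + τ / 2))
          (NormedSpace.exp (((τ / 2 : ℝ) : ℂ) • generator H L γ t) *
            (X + ((τ / 2 : ℝ) : ℂ) • jump L (fun k => γ k t) X) *
            NormedSpace.exp (((τ / 2 : ℝ) : ℂ) • (generator H L γ t)ᴴ)) *
        NormedSpace.exp (((τ / 2 : ℝ) : ℂ) • (generator H L γ (t + τ / 2))ᴴ)) := by
  rw [fremStep, jump_apply L (fun k => γ k (t + τ / 2)), Finset.mul_sum, Finset.sum_mul]
  simp only [mul_smul_comm, smul_mul_assoc]
  rfl

theorem fremStep_smul (τ t : ℝ) (c : ℂ) (X : Matrix (Fin m) (Fin m) ℂ) :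
    fremStep H L γ τ t (c • X) = c • fremStep H L γ τ t X := by
  simp only [fremStep_eq, map_smul, map_add, mul_smul_comm, smul_mul_assoc, smul_add, mul_add,
    add_mul, smul_comm c]

theorem fremStep_sub (τ t : ℝ) (X Y : Matrix (Fin m) (Fin m) ℂ) :
    fremStep H L γ τ t (X - Y) = fremStep H L γ τ t X - fremStep H L γ τ t Y := by
  simp only [fremStep_eq, map_sub, map_add, mul_add, mul_sub, add_mul, sub_mul, smul_add,
    smul_sub]
  abel

variable {H L γ}

theorem generator_conjTranspose {t : ℝ} (hH : (H t).IsHermitian) :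
    (generator H L γ t)ᴴ =
      Complex.I • H t - (1 / 2 : ℂ) • ∑ k, (γ k t : ℂ) • ((L k)ᴴ * L k) := by
  simp [generator, conjTranspose_sub, conjTranspose_sum, conjTranspose_smul, hH.eq]

theorem lindbladRHS_eq {t : ℝ} (hH : (H t).IsHermitian) (X : Matrix (Fin m) (Fin m) ℂ) :
    lindbladRHS H L γ t X = generator H L γ t * X + X * (generator H L γ t)ᴴ +
      jump L (fun k => γ k t) X := by
  rw [generator_conjTranspose hH, lindbladRHS, generator, jump_apply]
  simp only [smul_sub, smul_add, Finset.sum_sub_distrib, Finset.sum_add_distrib, sub_mul, mul_sub,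
    Finset.smul_sum, Finset.sum_mul, Finset.mul_sum, smul_mul_assoc, mul_smul_comm,
    smul_comm (1 / 2 : ℂ)]
  module

theorem neg_generator_add_posSemidef {t : ℝ} (hH : (H t).IsHermitian) (hγ : ∀ k, 0 ≤ γ k t) :
    (-(generator H L γ t + (generator H L γ t)ᴴ)).PosSemidef := by
  have e : -(generator H L γ t + (generator H L γ t)ᴴ) =
      ∑ k, (γ k t : ℂ) • ((L k)ᴴ * L k) := by
    rw [generator_conjTranspose hH, generator]; module
  rw [e]
  exact posSemidef_sum _ fun k _ =>
    (posSemidef_conjTranspose_mul_self (L k)).smul (Complex.zero_le_real.2 (hγ k))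

theorem exp_smul_conjTranspose (τ : ℝ) (B : Matrix (Fin m) (Fin m) ℂ) :
    NormedSpace.exp ((τ : ℂ) • Bᴴ) = (NormedSpace.exp ((τ : ℂ) • B))ᴴ := by
  rw [← Matrix.exp_conjTranspose, conjTranspose_smul]
  simp

theorem jump_posSemidef {g : Fin K → ℝ} (hg : ∀ k, 0 ≤ g k) {X : Matrix (Fin m) (Fin m) ℂ}
    (hX : X.PosSemidef) : (jump L g X).PosSemidef :=
  posSemidef_sum _ fun k _ =>
    (hX.mul_mul_conjTranspose_same (L k)).smul (Complex.zero_le_real.2 (hg k))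

/-- The step is built from conjugations with nonnegative weights. The no-jump term is kept apart
because its conjugation is by an invertible matrix, which later keeps the trace away from zero. -/
theorem fremStep_eq_add_posSemidef {τ t : ℝ} (hτ : 0 ≤ τ) (hγ : ∀ k, 0 ≤ γ k t)
    (hγ' : ∀ k, 0 ≤ γ k (t + τ / 2)) {X : Matrix (Fin m) (Fin m) ℂ} (hX : X.PosSemidef) :
    ∃ P : Matrix (Fin m) (Fin m) ℂ, P.PosSemidef ∧ fremStep H L γ τ t X =
      NormedSpace.exp ((τ : ℂ) • generator H L γ (t + τ / 2)) * X *
        (NormedSpace.exp ((τ : ℂ) • generator H L γ (t + τ / 2)))ᴴ + P := by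
  rw [fremStep_eq]
  simp only [exp_smul_conjTranspose]
  refine ⟨_, ?_, rfl⟩
  refine PosSemidef.smul ?_ (Complex.zero_le_real.2 hτ)
  refine PosSemidef.mul_mul_conjTranspose_same (jump_posSemidef hγ' ?_) _
  refine PosSemidef.mul_mul_conjTranspose_same (hX.add ?_) _
  exact (jump_posSemidef hγ hX).smul (Complex.zero_le_real.2 (by linarith))

theorem fremStep_posSemidef {τ t : ℝ} (hτ : 0 ≤ τ) (hγ : ∀ k, 0 ≤ γ k t)
    (hγ' : ∀ k, 0 ≤ γ k (t + τ / 2)) {X : Matrix (Fin m) (Fin m) ℂ} (hX : X.PosSemidef) :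
    (fremStep H L γ τ t X).PosSemidef := by
  obtain ⟨P, hP, e⟩ := fremStep_eq_add_posSemidef (H := H) (L := L) hτ hγ hγ' hX
  rw [e]
  exact (hX.mul_mul_conjTranspose_same _).add hP

theorem fremStep_trace_ne_zero {τ t : ℝ} (hτ : 0 ≤ τ) (hγ : ∀ k, 0 ≤ γ k t)
    (hγ' : ∀ k, 0 ≤ γ k (t + τ / 2)) {X : Matrix (Fin m) (Fin m) ℂ} (hX : X.PosSemidef)
    (htr : X.trace ≠ 0) : (fremStep H L γ τ t X).trace ≠ 0 := by
  obtain ⟨P, hP, e⟩ := fremStep_eq_add_posSemidef (H := H) (L := L) hτ hγ hγ' hX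
  have h1 := hX.mul_mul_conjTranspose_same
    (NormedSpace.exp ((τ : ℂ) • generator H L γ (t + τ / 2)))
  rw [e, trace_add]
  intro h0
  have h2 := ((add_eq_zero_iff_of_nonneg h1.trace_nonneg hP.trace_nonneg).1 h0).1
  rw [h1.trace_eq_zero_iff] at h2
  have hu : IsUnit (NormedSpace.exp ((τ : ℂ) • generator H L γ (t + τ / 2))) :=
    Matrix.isUnit_exp _
  have hu' := hu.star
  rw [star_eq_conjTranspose] at hu'
  rw [hu'.mul_left_eq_zero, hu.mul_right_eq_zero] at h2
  exact htr (by simp [h2])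

end Step

/-! ### Stability, truncation error and trace conservation -/

section Evolution

variable {m K : ℕ}

/-- Hermitian `H(t)` and nonnegative rates `γₖ(t)`, twice continuously differentiable on
`[0, T]`. -/
structure IsAdmissible (H : ℝ → Matrix (Fin m) (Fin m) ℂ) (γ : Fin K → ℝ → ℝ) (T : ℝ) : Prop where
  isHermitian : ∀ t ∈ Icc 0 T, (H t).IsHermitian
  nonneg : ∀ k, ∀ t ∈ Icc 0 T, 0 ≤ γ k t
  contDiffOn : ∀ i j, ContDiffOn ℝ 2 (fun t => H t i j) (Icc 0 T)
  contDiffOn_rate : ∀ k, ContDiffOn ℝ 2 (γ k) (Icc 0 T)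

variable {H : ℝ → Matrix (Fin m) (Fin m) ℂ} {L : Fin K → Matrix (Fin m) (Fin m) ℂ}
  {γ : Fin K → ℝ → ℝ} {T : ℝ}

theorem stabilityConst_nonneg (h : IsAdmissible H γ T) (L : Fin K → Matrix (Fin m) (Fin m) ℂ) :
    0 ≤ stabilityConst L γ T := by
  refine Finset.sum_nonneg fun k _ => mul_nonneg (Real.sSup_nonneg ?_) (sq_nonneg _)
  rintro _ ⟨t, ht, rfl⟩
  exact h.nonneg k t ht

theorem traceNorm_conj_le (U X : Matrix (Fin m) (Fin m) ℂ) :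
    traceNorm (U * X * Uᴴ) ≤ ‖U‖ ^ 2 * traceNorm X := by
  simpa [l2_opNorm_conjTranspose, sq] using traceNorm_mul_mul_le U X Uᴴ

theorem traceNorm_jump_le (h : IsAdmissible H γ T) {t : ℝ} (ht : t ∈ Icc 0 T)
    (X : Matrix (Fin m) (Fin m) ℂ) :
    traceNorm (jump L (fun k => γ k t) X) ≤ stabilityConst L γ T * traceNorm X := by
  rw [jump_apply, stabilityConst, Finset.sum_mul]
  refine (traceNorm_sum_le _ _).trans (Finset.sum_le_sum fun k _ => ?_)
  have hb : BddAbove (γ k '' Icc 0 T) :=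
    (isCompact_Icc.image_of_continuousOn (h.contDiffOn_rate k).continuousOn).bddAbove
  have hle : γ k t ≤ sSup (γ k '' Icc 0 T) := le_csSup hb (mem_image_of_mem _ ht)
  have h0 := h.nonneg k t ht
  refine (traceNorm_smul_le _ _).trans ?_
  rw [Complex.norm_real, Real.norm_of_nonneg h0, mul_assoc (sSup _)]
  refine mul_le_mul hle ?_ (traceNorm_nonneg _) (h0.trans hle)
  refine (traceNorm_conj_le _ _).trans (mul_le_mul_of_nonneg_right ?_ (traceNorm_nonneg _))
  exact pow_le_pow_left₀ (norm_nonneg _) (l2_opNorm_le_traceNorm _) 2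

theorem traceNorm_exp_conj_le (h : IsAdmissible H γ T) {t τ : ℝ} (ht : t ∈ Icc 0 T) (hτ : 0 ≤ τ)
    (X : Matrix (Fin m) (Fin m) ℂ) :
    traceNorm (NormedSpace.exp ((τ : ℂ) • generator H L γ t) * X *
      NormedSpace.exp ((τ : ℂ) • (generator H L γ t)ᴴ)) ≤ traceNorm X := by
  rw [exp_smul_conjTranspose]
  refine (traceNorm_conj_le _ _).trans (mul_le_of_le_one_left (traceNorm_nonneg _) ?_)
  exact pow_le_one₀ (norm_nonneg _) (l2_opNorm_exp_smul_le_one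
    (neg_generator_add_posSemidef (h.isHermitian t ht) fun k => h.nonneg k t ht) hτ)

/-- No positivity of `X` is assumed: the bound is applied to the error, a difference of two states.
-/
theorem traceNorm_fremStep_le (h : IsAdmissible H γ T) {t τ : ℝ} (ht : 0 ≤ t) (hτ : 0 ≤ τ)
    (htT : t + τ ≤ T) (X : Matrix (Fin m) (Fin m) ℂ) :
    traceNorm (fremStep H L γ τ t X) ≤ Real.exp (stabilityConst L γ T * τ) * traceNorm X := by
  have ht1 : t ∈ Icc 0 T := ⟨ht, by linarith⟩
  have ht2 : t + τ / 2 ∈ Icc 0 T := ⟨by linarith, by linarith⟩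
  set c := stabilityConst L γ T with hc
  have hc0 : 0 ≤ c := stabilityConst_nonneg h L
  have hx := traceNorm_nonneg X
  rw [fremStep_eq]
  set Y := NormedSpace.exp (((τ / 2 : ℝ) : ℂ) • generator H L γ t) *
            (X + ((τ / 2 : ℝ) : ℂ) • jump L (fun k => γ k t) X) *
            NormedSpace.exp (((τ / 2 : ℝ) : ℂ) • (generator H L γ t)ᴴ)
  have hY : traceNorm Y ≤ (1 + τ / 2 * c) * traceNorm X := by
    refine (traceNorm_exp_conj_le h ht1 (by linarith) _).trans ((traceNorm_add_le _ _).trans ?_)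
    have h1 := traceNorm_smul_le ((τ / 2 : ℝ) : ℂ) (jump L (fun k => γ k t) X)
    rw [Complex.norm_real, Real.norm_of_nonneg (by linarith)] at h1
    have h2 := mul_le_mul_of_nonneg_left (traceNorm_jump_le (L := L) h ht1 X)
      (by linarith : (0 : ℝ) ≤ τ / 2)
    rw [← hc] at h2
    nlinarith
  refine (traceNorm_add_le _ _).trans ?_
  have h1 := traceNorm_exp_conj_le (L := L) h ht2 hτ X
  have h2 : traceNorm ((τ : ℂ) • (NormedSpace.exp (((τ / 2 : ℝ) : ℂ) • generator H L γ (t + τ / 2)) *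
        jump L (fun k => γ k (t + τ / 2)) Y *
        NormedSpace.exp (((τ / 2 : ℝ) : ℂ) • (generator H L γ (t + τ / 2))ᴴ))) ≤
      τ * (c * ((1 + τ / 2 * c) * traceNorm X)) := by
    refine (traceNorm_smul_le _ _).trans ?_
    rw [Complex.norm_real, Real.norm_of_nonneg hτ]
    refine mul_le_mul_of_nonneg_left ?_ hτ
    refine (traceNorm_exp_conj_le h ht2 (by linarith) _).trans ?_
    exact (traceNorm_jump_le h ht2 Y).trans (mul_le_mul_of_nonneg_left hY hc0)
  calc _ ≤ traceNorm X + τ * (c * ((1 + τ / 2 * c) * traceNorm X)) := add_le_add h1 h2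
    _ = (1 + c * τ + (c * τ) ^ 2 / 2) * traceNorm X := by ring
    _ ≤ _ := mul_le_mul_of_nonneg_right
      (Real.quadratic_le_exp_of_nonneg (mul_nonneg hc0 hτ)) hx

theorem IsLindbladSolution.mono {a b c d : ℝ} {ρ : ℝ → Matrix (Fin m) (Fin m) ℂ}
    (hρ : IsLindbladSolution H L γ a b ρ) (hac : a ≤ c) (hdb : d ≤ b) :
    IsLindbladSolution H L γ c d ρ := fun t ht i j =>
  (hρ t (Icc_subset_Icc hac hdb ht) i j).mono (Icc_subset_Icc hac hdb)

theorem contDiffOn_generator_entry (h : IsAdmissible H γ T) (i j : Fin m) :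
    ContDiffOn ℝ 2 (fun t => generator H L γ t i j) (Icc 0 T) := by
  have e : (fun t => generator H L γ t i j) = fun t =>
      -Complex.I * H t i j - 1 / 2 * ∑ k, (γ k t : ℂ) * ((L k)ᴴ * L k) i j := by
    funext t
    simp [generator, Matrix.sum_apply]
  rw [e]
  refine (contDiffOn_const.mul (h.contDiffOn i j)).sub (contDiffOn_const.mul
    (ContDiffOn.sum fun k _ => ContDiffOn.mul ?_ contDiffOn_const))
  exact Complex.ofRealCLM.contDiff.comp_contDiffOn (h.contDiffOn_rate k)

/-- Third order truncation error for all solutions with bounded initial value. -/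
theorem exists_truncation_bound (h : IsAdmissible H γ T) (hT : 0 < T) (M : ℝ) :
    ∃ C, 0 < C ∧ ∀ (t τ : ℝ) (ρ : ℝ → Matrix (Fin m) (Fin m) ℂ), 0 ≤ t → 0 ≤ τ → t + τ ≤ T →
      IsLindbladSolution H L γ t (t + τ) ρ → ‖ρ t‖ ≤ M →
      traceNorm (ρ (t + τ) - fremStep H L γ τ t (ρ t)) ≤ C * τ ^ 3 := by
  have hA : ContDiffOn ℝ 2 (generator H L γ) (Icc 0 T) :=
    contDiffOn_of_entries (contDiffOn_generator_entry h)
  have hA' : ContDiffOn ℝ 2 (fun t => (generator H L γ t)ᴴ) (Icc 0 T) :=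
    contDiffOn_of_entries fun i j =>
      Complex.conjCLE.contDiff.comp_contDiffOn (contDiffOn_generator_entry h j i)
  set J : ℝ → Matrix (Fin m) (Fin m) ℂ →L[ℝ] Matrix (Fin m) (Fin m) ℂ := fun t =>
    ∑ k, γ k t • ContinuousLinearMap.mulLeftRight ℝ _ (L k) (L k)ᴴ with hJdef
  have hJ : ContDiffOn ℝ 2 J (Icc 0 T) :=
    ContDiffOn.sum fun k _ => (h.contDiffOn_rate k).smul contDiffOn_const
  have hJa : ∀ t X, J t X = jump L (fun k => γ k t) X := fun t X => by
    rw [hJdef, jump_apply]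
    simp [Complex.coe_smul]
  obtain ⟨C, hC⟩ := exists_scheme_truncation_bound hT hA hA' hJ M
  -- The factor `m` passes from operator norm to trace norm; the added `1` makes the constant
  -- strictly positive.
  refine ⟨m * |C| + 1, by positivity, fun t τ ρ ht hτ htT hρ hM => ?_⟩
  have h1 := hC t τ ρ ht hτ htT (fun u hu => by
    rw [hJa, ← lindbladRHS_eq (h.isHermitian u ⟨ht.trans hu.1, hu.2.trans htT⟩)]
    exact hasDerivWithinAt_of_entries (hρ u hu)) hM
  simp only [hJa] at h1
  have e : fremStep H L γ τ t (ρ t) = _ := fremStep_eq H L γ τ t (ρ t)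
  simp only [Complex.coe_smul] at e
  rw [← e] at h1
  refine (traceNorm_le_mul_l2_opNorm _).trans ?_
  calc (m : ℝ) * ‖ρ (t + τ) - fremStep H L γ τ t (ρ t)‖ ≤ m * (C * τ ^ 3) := by gcongr
    _ ≤ m * (|C| * τ ^ 3) := by gcongr; exact le_abs_self C
    _ ≤ (m * |C| + 1) * τ ^ 3 := by nlinarith [pow_nonneg hτ 3]

theorem trace_lindbladRHS (H : ℝ → Matrix (Fin m) (Fin m) ℂ)
    (L : Fin K → Matrix (Fin m) (Fin m) ℂ) (γ : Fin K → ℝ → ℝ) (t : ℝ)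
    (X : Matrix (Fin m) (Fin m) ℂ) : (lindbladRHS H L γ t X).trace = 0 := by
  rw [lindbladRHS, trace_add, trace_smul, trace_sub, trace_mul_comm (H t), sub_self, smul_zero,
    zero_add, trace_sum]
  refine Finset.sum_eq_zero fun k _ => ?_
  rw [trace_smul, trace_sub, trace_smul, trace_add, trace_mul_comm (L k * X), ← mul_assoc,
    trace_mul_comm X]
  simp only [smul_eq_mul]
  ring

theorem IsLindbladSolution.trace_eq {ρ : ℝ → Matrix (Fin m) (Fin m) ℂ}
    (hρ : IsLindbladSolution H L γ 0 T ρ) {t : ℝ} (ht : t ∈ Icc 0 T) :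
    (ρ t).trace = (ρ 0).trace := by
  have hd : ∀ u ∈ Icc 0 T, HasDerivWithinAt (fun s => (ρ s).trace) 0 (Icc 0 T) u := fun u hu => by
    rw [← trace_lindbladRHS H L γ u (ρ u)]
    exact HasDerivWithinAt.fun_sum fun i _ => hρ u hu i i
  have := (convex_Icc 0 T).norm_image_sub_le_of_norm_hasDerivWithin_le (C := 0) hd (by simp)
    (left_mem_Icc.2 (ht.1.trans ht.2)) ht
  rw [zero_mul, norm_le_zero_iff, sub_eq_zero] at this
  exact this

end Evolution

/-! ### Error accumulation, positivity of the flow and normalization -/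

section Global

variable {m K : ℕ} {H : ℝ → Matrix (Fin m) (Fin m) ℂ} {L : Fin K → Matrix (Fin m) (Fin m) ℂ}
  {γ : Fin K → ℝ → ℝ} {T : ℝ}

theorem le_mul_geom_sum {e : ℕ → ℝ} {a d : ℝ} {N : ℕ} (ha : 0 ≤ a) (h0 : e 0 ≤ 0)
    (h : ∀ n < N, e (n + 1) ≤ a * e n + d) : ∀ n ≤ N, e n ≤ d * ∑ i ∈ Finset.range n, a ^ i := by
  intro n
  induction n with
  | zero => intro _; simpa using h0
  | succ n ih =>
    intro hn
    refine (h n hn).trans ?_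
    have := mul_le_mul_of_nonneg_left (ih (Nat.le_of_succ_le hn)) ha
    rw [geom_sum_succ]
    linarith

theorem geom_sum_le_errorConst {C₁ C₂ τ : ℝ} (hC₁ : 0 ≤ C₁) (hC₂ : 0 ≤ C₂) (hτ : 0 < τ) {n : ℕ}
    (hn : n * τ ≤ T) :
    C₁ * τ ^ 3 * ∑ i ∈ Finset.range n, Real.exp (C₂ * τ) ^ i ≤ errorConst C₁ C₂ T * τ ^ 2 := by
  unfold errorConst
  split_ifs with h
  · subst h
    simp only [zero_mul, Real.exp_zero, one_pow, Finset.sum_const, Finset.card_range, nsmul_eq_mul,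
      mul_one]
    calc C₁ * τ ^ 3 * n = C₁ * (n * τ) * τ ^ 2 := by ring
      _ ≤ C₁ * T * τ ^ 2 := by gcongr
  · have hC₂' : 0 < C₂ := lt_of_le_of_ne hC₂ (Ne.symm h)
    have hx : 0 < C₂ * τ := by positivity
    -- The geometric sum equals `(e^{n C₂ τ} - 1) / (e^{C₂ τ} - 1)`; this bounds the denominator
    -- from below and costs one power of `τ`.
    have h1 : C₂ * τ ≤ Real.exp (C₂ * τ) - 1 := by linarith [Real.add_one_le_exp (C₂ * τ)]
    have hS : 0 ≤ ∑ i ∈ Finset.range n, Real.exp (C₂ * τ) ^ i :=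
      Finset.sum_nonneg fun _ _ => by positivity
    have h2 : (∑ i ∈ Finset.range n, Real.exp (C₂ * τ) ^ i) * (C₂ * τ) ≤
        Real.exp (C₂ * T) - 1 := by
      refine (mul_le_mul_of_nonneg_left h1 hS).trans ?_
      rw [geom_sum_mul, ← Real.exp_nat_mul]
      have : (n : ℝ) * (C₂ * τ) ≤ C₂ * T := by nlinarith
      linarith [Real.exp_le_exp.2 this]
    calc _ = C₁ / C₂ * ((∑ i ∈ Finset.range n, Real.exp (C₂ * τ) ^ i) * (C₂ * τ)) * τ ^ 2 := by
          field_simp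
      _ ≤ _ := by gcongr

/-- The scheme without normalization. -/
noncomputable def unnormalizedFREM (H : ℝ → Matrix (Fin m) (Fin m) ℂ)
    (L : Fin K → Matrix (Fin m) (Fin m) ℂ) (γ : Fin K → ℝ → ℝ)
    (τ : ℝ) (X₀ : Matrix (Fin m) (Fin m) ℂ) : ℕ → Matrix (Fin m) (Fin m) ℂ
  | 0 => X₀
  | n + 1 => fremStep H L γ τ (n * τ) (unnormalizedFREM H L γ τ X₀ n)

theorem grid_mem {τ : ℝ} {N n : ℕ} (hτ : 0 ≤ τ) (hN : N * τ = T) (hn : n < N) :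
    n * τ + τ ≤ T := by
  have : (n : ℝ) + 1 ≤ N := by exact_mod_cast hn
  nlinarith

theorem unnormalizedFREM_posSemidef_and_trace_ne_zero (h : IsAdmissible H γ T) {τ : ℝ} {N : ℕ}
    (hτ : 0 ≤ τ) (hN : N * τ = T) {X₀ : Matrix (Fin m) (Fin m) ℂ} (hX : IsDensity X₀) :
    ∀ n ≤ N, (unnormalizedFREM H L γ τ X₀ n).PosSemidef ∧
      (unnormalizedFREM H L γ τ X₀ n).trace ≠ 0 := by
  intro n
  induction n with
  | zero => intro _; exact ⟨hX.1, by rw [unnormalizedFREM, hX.2]; exact one_ne_zero⟩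
  | succ n ih =>
    intro hn
    obtain ⟨h1, h2⟩ := ih (Nat.le_of_succ_le hn)
    have hg := grid_mem hτ hN hn
    have h0 : 0 ≤ (n : ℝ) * τ := by positivity
    have hγ : ∀ k, 0 ≤ γ k (n * τ) := fun k => h.nonneg k _ ⟨h0, by linarith⟩
    have hγ' : ∀ k, 0 ≤ γ k (n * τ + τ / 2) := fun k => h.nonneg k _ ⟨by linarith, by linarith⟩
    exact ⟨fremStep_posSemidef hτ hγ hγ' h1, fremStep_trace_ne_zero hτ hγ hγ' h1 h2⟩

/-- The local error is assumed only along the given `ρ`. This lets the estimate serve twice: to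
prove positivity of the flow, and then with the given `C₁`. -/
theorem traceNorm_sub_unnormalizedFREM_le (h : IsAdmissible H γ T) {τ C : ℝ} {N : ℕ}
    (hτ : 0 < τ) (hN : N * τ = T) (hC : 0 ≤ C) {ρ : ℝ → Matrix (Fin m) (Fin m) ℂ}
    (hloc : ∀ n < N, traceNorm (ρ (n * τ + τ) - fremStep H L γ τ (n * τ) (ρ (n * τ))) ≤ C * τ ^ 3) :
    ∀ n ≤ N, traceNorm (ρ (n * τ) - unnormalizedFREM H L γ τ (ρ 0) n) ≤
      errorConst C (stabilityConst L γ T) T * τ ^ 2 := by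
  intro n hn
  have hnT : n * τ ≤ T := by
    rw [← hN]
    exact mul_le_mul_of_nonneg_right (by exact_mod_cast hn) hτ.le
  refine (le_mul_geom_sum (e := fun n => traceNorm (ρ (n * τ) - unnormalizedFREM H L γ τ (ρ 0) n))
    (Real.exp_nonneg (stabilityConst L γ T * τ)) ?_ (fun n hn => ?_) n hn).trans
    (geom_sum_le_errorConst hC (stabilityConst_nonneg h L) hτ hnT)
  · simp [unnormalizedFREM, traceNorm_zero]
  · have e : ρ ((n + 1 : ℕ) * τ) - unnormalizedFREM H L γ τ (ρ 0) (n + 1) =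
        fremStep H L γ τ (n * τ) (ρ (n * τ) - unnormalizedFREM H L γ τ (ρ 0) n) +
          (ρ (n * τ + τ) - fremStep H L γ τ (n * τ) (ρ (n * τ))) := by
      rw [fremStep_sub, unnormalizedFREM, Nat.cast_succ, add_one_mul]
      abel
    simp only [e]
    exact (traceNorm_add_le _ _).trans (add_le_add (traceNorm_fremStep_le h (by positivity) hτ.le
      (grid_mem hτ.le hN hn) _) (hloc n hn))

theorem isClosed_posSemidef : IsClosed {X : Matrix (Fin m) (Fin m) ℂ | X.PosSemidef} := by
  simp only [posSemidef_iff_dotProduct_mulVec, ofPred_and, ofPred_forall]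
  refine IsClosed.inter (isClosed_eq (continuous_id.matrix_conjTranspose) continuous_id)
    (isClosed_iInter fun x => isClosed_le continuous_const ?_)
  exact continuous_const.dotProduct (continuous_id.matrix_mulVec continuous_const)

/-- The Lindblad flow preserves positivity, being the limit of a positive scheme. -/
theorem IsLindbladSolution.isDensity (h : IsAdmissible H γ T) (hT : 0 < T)
    {ρ : ℝ → Matrix (Fin m) (Fin m) ℂ} (hρ : IsLindbladSolution H L γ 0 T ρ)
    (h0 : IsDensity (ρ 0)) {N n : ℕ} (hN : 0 < N) (hn : n ≤ N) :
    IsDensity (ρ (n * (T / N))) := by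
  have hNr : (0 : ℝ) < N := by exact_mod_cast hN
  have hcont : ContinuousOn ρ (Icc 0 T) := fun t ht =>
    (hasDerivWithinAt_of_entries (hρ t ht)).continuousWithinAt
  -- Positivity is not yet known, so the truncation bound is taken for the maximal size of this
  -- solution rather than for density matrices.
  obtain ⟨M, hM⟩ := isCompact_Icc.exists_bound_of_continuousOn hcont
  obtain ⟨C, hC, hloc⟩ := exists_truncation_bound (L := L) h hT M
  have hnT : (n : ℝ) * (T / N) ∈ Icc 0 T := by
    refine ⟨by positivity, ?_⟩
    calc (n : ℝ) * (T / N) ≤ N * (T / N) := by gcongr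
      _ = T := by field_simp
  refine ⟨?_, (hρ.trace_eq hnT).trans h0.2⟩
  -- Each coarse interval is cut into `j + 1` pieces, so that the fixed time `n T / N` stays a grid
  -- point, now with index `n (j + 1)`.
  set u : ℕ → Matrix (Fin m) (Fin m) ℂ := fun j =>
    unnormalizedFREM H L γ (T / (N * (j + 1) : ℕ)) (ρ 0) (n * (j + 1)) with hu
  have hτ : ∀ j : ℕ, 0 < T / (N * (j + 1) : ℕ) := fun j => by positivity
  have hgrid : ∀ j : ℕ, ((N * (j + 1) : ℕ) : ℝ) * (T / (N * (j + 1) : ℕ)) = T := fun j => by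
    have : ((N * (j + 1) : ℕ) : ℝ) ≠ 0 := by positivity
    field_simp
  have hle : ∀ j : ℕ, n * (j + 1) ≤ N * (j + 1) := fun j => Nat.mul_le_mul_right _ hn
  have hpos : ∀ j, (u j).PosSemidef := fun j =>
    (unnormalizedFREM_posSemidef_and_trace_ne_zero h (hτ j).le (hgrid j) h0 _ (hle j)).1
  set D := errorConst C (stabilityConst L γ T) T
  have herr : ∀ j, ‖ρ (n * (T / N)) - u j‖ ≤ D * (T / (N * (j + 1) : ℕ)) ^ 2 := fun j => by
    refine (l2_opNorm_le_traceNorm _).trans ?_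
    have e : (n : ℝ) * (T / N) = ((n * (j + 1) : ℕ) : ℝ) * (T / (N * (j + 1) : ℕ)) := by
      have : (j : ℝ) + 1 ≠ 0 := by positivity
      push_cast
      field_simp
    rw [e]
    refine traceNorm_sub_unnormalizedFREM_le h (hτ j) (hgrid j) hC.le (fun k hk => ?_) _ (hle j)
    have hk' := grid_mem (hτ j).le (hgrid j) hk
    have hk0 : 0 ≤ (k : ℝ) * (T / (N * (j + 1) : ℕ)) := by positivity
    exact hloc _ _ ρ hk0 (hτ j).le hk' (hρ.mono hk0 hk') (hM _ ⟨hk0, by linarith [hτ j]⟩)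
  have hlim : Filter.Tendsto (fun j : ℕ => D * (T / (N * (j + 1) : ℕ)) ^ 2) Filter.atTop
      (nhds 0) := by
    have h1 : Filter.Tendsto (fun j : ℕ => T / N * (1 / ((j : ℝ) + 1))) Filter.atTop (nhds 0) := by
      simpa using tendsto_one_div_add_atTop_nhds_zero_nat.const_mul (T / N)
    have h2 := (h1.pow 2).const_mul D
    simp only [ne_eq, OfNat.ofNat_ne_zero, not_false_eq_true, zero_pow, mul_zero] at h2
    refine h2.congr fun j => ?_
    push_cast
    rw [div_mul_div_comm, mul_one]
  have htend : Filter.Tendsto u Filter.atTop (nhds (ρ (n * (T / N)))) := by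
    rw [tendsto_iff_norm_sub_tendsto_zero]
    refine squeeze_zero (fun _ => norm_nonneg _) (fun j => ?_) hlim
    rw [norm_sub_rev]
    exact herr j
  exact isClosed_posSemidef.mem_of_tendsto htend (Filter.Eventually.of_forall hpos)

/-- The step is homogeneous, so scalar factors from earlier normalizations cancel in the next one.
-/
theorem normalizedFREM_eq (h : IsAdmissible H γ T) {τ : ℝ} {N : ℕ} (hτ : 0 ≤ τ) (hN : N * τ = T)
    {X₀ : Matrix (Fin m) (Fin m) ℂ} (hX : IsDensity X₀) : ∀ n ≤ N,
      normalizedFREM H L γ τ X₀ n = (unnormalizedFREM H L γ τ X₀ n).trace⁻¹ •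
        unnormalizedFREM H L γ τ X₀ n := by
  intro n
  induction n with
  | zero => intro _; simp [normalizedFREM, unnormalizedFREM, hX.2]
  | succ n ih =>
    intro hn
    have hc := inv_ne_zero (unnormalizedFREM_posSemidef_and_trace_ne_zero (L := L) h hτ hN hX n
      (Nat.le_of_succ_le hn)).2
    rw [normalizedFREM, ih (Nat.le_of_succ_le hn), fremStep_smul, trace_smul, smul_smul,
      smul_eq_mul, mul_inv, mul_right_comm, inv_mul_cancel₀ hc, one_mul, unnormalizedFREM]

/-- For positive `X`, normalizing moves it by `|1 - 1 / Tr X| ‖X‖₁ = |Tr X - 1| = |Tr (ρ - X)|`, at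
most `‖ρ - X‖₁`. This is the source of the factor `2`. -/
theorem traceNorm_sub_inv_trace_smul_le {ρ X : Matrix (Fin m) (Fin m) ℂ} (hρ : ρ.trace = 1)
    (hX : X.PosSemidef) (htr : X.trace ≠ 0) :
    traceNorm (ρ - X.trace⁻¹ • X) ≤ 2 * traceNorm (ρ - X) := by
  have e : ρ - X.trace⁻¹ • X = (ρ - X) + (1 - X.trace⁻¹) • X := by module
  have h1 : ‖1 - X.trace⁻¹‖ * traceNorm X ≤ traceNorm (ρ - X) := by
    calc ‖1 - X.trace⁻¹‖ * traceNorm X ≤ ‖1 - X.trace⁻¹‖ * ‖X.trace‖ :=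
          mul_le_mul_of_nonneg_left (traceNorm_le_of_posSemidef hX) (norm_nonneg _)
      _ = ‖(ρ - X).trace‖ := by
          rw [← norm_mul, sub_mul, one_mul, inv_mul_cancel₀ htr, trace_sub, hρ, norm_sub_rev]
      _ ≤ _ := norm_trace_le _
  rw [e]
  linarith [traceNorm_add_le (ρ - X) ((1 - X.trace⁻¹) • X), traceNorm_smul_le (1 - X.trace⁻¹) X]

end Global

end LindbladFREM

/-! ### The main theorem -/

open LindbladFREM in
theorem theorem3p2 {m K : ℕ} (H : ℝ → Matrix (Fin m) (Fin m) ℂ)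
    (L : Fin K → Matrix (Fin m) (Fin m) ℂ) (γ : Fin K → ℝ → ℝ) (T : ℝ) (hT : 0 < T)
    (hH : ∀ t ∈ Set.Icc 0 T, (H t).IsHermitian)
    (hγ : ∀ k, ∀ t ∈ Set.Icc 0 T, 0 ≤ γ k t)
    (hHsmooth : ∀ i j, ContDiffOn ℝ 2 (fun t => H t i j) (Set.Icc 0 T))
    (hγsmooth : ∀ k, ContDiffOn ℝ 2 (γ k) (Set.Icc 0 T)) :
    (∃ C₁ : ℝ, 0 < C₁ ∧ IsTruncationConst H L γ T C₁) ∧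
    ∀ C₁ : ℝ, IsTruncationConst H L γ T C₁ →
      ∀ ρ : ℝ → Matrix (Fin m) (Fin m) ℂ,
        IsLindbladSolution H L γ 0 T ρ → IsDensity (ρ 0) →
        ∀ N : ℕ, 0 < N → ∀ n : ℕ, n ≤ N →
          traceNorm (ρ (n * (T / N)) - normalizedFREM H L γ (T / N) (ρ 0) n)
            ≤ 2 * errorConst C₁ (stabilityConst L γ T) T * (T / N) ^ 2 := by
  have h : IsAdmissible H γ T := ⟨hH, hγ, hHsmooth, hγsmooth⟩
  have hgrid : ∀ N : ℕ, 0 < N → (N : ℝ) * (T / N) = T := fun N hN => by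
    have : (N : ℝ) ≠ 0 := by positivity
    field_simp
  refine ⟨?_, fun C₁ hC₁ ρ hρ h0 N hN n hn => ?_⟩
  · obtain ⟨C, hC, hloc⟩ := exists_truncation_bound (L := L) h hT 1
    refine ⟨C, hC, fun N hN n hn ρ hρ hd => ?_⟩
    have hτ : 0 ≤ T / N := by positivity
    rw [add_one_mul] at hρ ⊢
    exact hloc _ _ ρ (by positivity) hτ (grid_mem hτ (hgrid N hN) hn) hρ
      ((l2_opNorm_le_traceNorm _).trans hd.traceNorm_le)
  · have hτ : 0 < T / N := by positivity
    -- The sign of `C₁` is not assumed; it follows from testing on the given solution with a single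
    -- step of length `T`.
    have hC₁0 : 0 ≤ C₁ := by
      have h1 := hC₁ 1 one_pos 0 one_pos ρ (by simpa using hρ) (by simpa using h0)
      have h2 := (traceNorm_nonneg _).trans h1
      exact nonneg_of_mul_nonneg_left h2 (by simpa using pow_pos hT 3)
    have hloc : ∀ n < N, traceNorm (ρ (n * (T / N) + T / N) -
        fremStep H L γ (T / N) (n * (T / N)) (ρ (n * (T / N)))) ≤ C₁ * (T / N) ^ 3 := by
      intro n hn
      have h1 := hC₁ N hN n hn ρ
      rw [add_one_mul] at h1
      exact h1 (hρ.mono (by positivity) (grid_mem hτ.le (hgrid N hN) hn))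
        (hρ.isDensity h hT h0 hN hn.le)
    obtain ⟨hp, htr⟩ := unnormalizedFREM_posSemidef_and_trace_ne_zero (L := L) h hτ.le (hgrid N hN)
      h0 n hn
    rw [normalizedFREM_eq h hτ.le (hgrid N hN) h0 n hn]
    refine (traceNorm_sub_inv_trace_smul_le (hρ.isDensity h hT h0 hN hn).2 hp htr).trans ?_
    rw [mul_assoc]
    exact mul_le_mul_of_nonneg_left
      (traceNorm_sub_unnormalizedFREM_le h hτ (hgrid N hN) hC₁0 hloc n hn) zero_le_two
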